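/- Write $\{0,1\}^*$ for the set of finite bit strings and $|x|$ for the length of $x$. "Almost always" (a.a.) means "for all sufficiently large $n\in\mathbb N$". A p.p.t. function $\bar G$ consists of a polynomial $q$ with coefficients in $\mathbb N$ and a partial function $\bar G(1^n,y,r)$ with values in $\{0,1\}^*$, defined for some of the triples with $n\in\mathbb N$ and $y,r\in\{0,1\}^*$, that is computable by a deterministic Turing machine in polynomial time (the machine always halts, and reports when $\bar G(1^n,y,r)$ is undefined). For $F:\{0,1\}^*\to\{0,1\}^*$ put $\bar F(x)=(1^{|x|},F(x))$, and let $$\mathbb P^n\{\bar F\circ\bar G=I\}$$ be the probability, over independent uniformly distributed $X_n\in\{0,1\}^n$ and $R_n\in\{0,1\}^{q(n)}$, that $\bar G(1^n,F(X_n),R_n)$ is defined and $\bar F(\bar G(1^n,F(X_n),R_n))=(1^n,F(X_n))$. A polynomial-time computable function $F:\{0,1\}^*\to\{0,1\}^*$ is a *weakly one-way function* if there is a real $c>0$ such that for every p.p.t. function $\bar G$, $$\mathbb P^n\{\bar F\circ\bar G=I\}\le 1-n^{-c}\quad\text{a.a.}$$ It is a *strongly one-way function* if for every real $c>0$ and every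 p.p.t. function $\bar G$, $$\mathbb P^n\{\bar F\circ\bar G=I\}\le n^{-c}\quad\text{a.a.}$$ If in addition, for every $n$, $F$ restricts to a bijection of $\{0,1\}^n$ onto itself, $F$ is called a *weakly*, respectively *strongly, one-way permutation*. **Corollary.** (i) If weakly one-way functions exist, then strongly one-way functions exist. (ii) If weakly one-way permutations exist, then strongly one-way permutations exist. -/

import Mathlib

namespace OneWay

/-- The set `{0,1}*` of finite bit strings. -/
abbrev BitStr : Type := List Bool

/-- The set `Ψ = {1}* × {0,1}* × {0,1}*`; the unary string `1ⁿ` is represented by `n`. -/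
abbrev Psi : Type := ℕ × BitStr × BitStr

/-- The string `1ⁿ # y # r` presented to a machine for the triple `(1ⁿ, y, r)`. The separator `#` is
`none`; the length is `n + |y| + |r| + 2`, so `n` is really written in unary. -/
def encodePsi (w : Psi) : List (Option Bool) :=
  (List.replicate w.1 true).map some ++ none :: (w.2.1.map some ++ none :: w.2.2.map some)

/-- The output string of a machine that computes a partial string function: the empty string reports
that the function is undefined, and `1x` reports the value `x`. -/
def encodeValue : Option BitStr → BitStr
  | none => []
  | some x => true :: x

/-- `F : {0,1}* → {0,1}*` is computable by a (multi-stack) Turing machine in polynomial time. -/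
def PolyTime (F : BitStr → BitStr) : Prop :=
  Nonempty (Turing.TM2ComputableInPolyTime (id : BitStr → List Bool) (id : BitStr → List Bool) F)

/-- A probabilistic polynomial-time partial function from `{1}* × {0,1}*` to `{0,1}*`. On the argument
`(1ⁿ, y)` it is given a string `r` of `coins(n)` random bits; the partial function
`G(1ⁿ, y, r)` (with `none` for "undefined") is computable by a Turing machine in polynomial time. -/
structure PPT where
  /-- the number of random bits, a polynomial in `n` -/
  coins : Polynomial ℕ
  /-- the underlying partial function of `(1ⁿ, y, r)` -/
  toFun : Psi → Option BitStr
  /-- it is computable in polynomial time -/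
  polyTime : Nonempty (Turing.TM2ComputableInPolyTime encodePsi encodeValue toFun)

/-- The auxiliary function `x ↦ (1^|x|, F x)` of `F`. -/
def aux (F : BitStr → BitStr) (x : BitStr) : ℕ × BitStr := (x.length, F x)

/-- The function `I(1ⁿ, y, r) = (1ⁿ, y)`. -/
def dropCoins (w : Psi) : ℕ × BitStr := (w.1, w.2.1)

/-- The distribution of `(1ⁿ, F(X), R)`, where `X` and `R` are independent and uniformly distributed on
`{0,1}ⁿ` and on `{0,1}^(q(n))`. -/
noncomputable def challenge (F : BitStr → BitStr) (q : Polynomial ℕ) (n : ℕ) : PMF Psi :=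
  (PMF.uniformOfFintype ((Fin n → Bool) × (Fin (q.eval n) → Bool))).map
    fun p => (n, F (List.ofFn p.1), List.ofFn p.2)

/-- The probability, under `challenge F G.coins n`, of the event that `G(1ⁿ, y, r)` is defined and
its value is mapped by the auxiliary function of `F` to `(1ⁿ, y)`. -/
noncomputable def invertProb (F : BitStr → BitStr) (G : PPT) (n : ℕ) : ℝ :=
  ((challenge F G.coins n).toOuterMeasure
    {w | (G.toFun w).map (aux F) = some (dropCoins w)}).toReal

/-- `F` is a weakly one-way function. -/
def IsWeaklyOneWay (F : BitStr → BitStr) : Prop :=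
  PolyTime F ∧ ∃ c : ℝ, 0 < c ∧ ∀ G : PPT, ∀ᶠ n : ℕ in Filter.atTop, invertProb F G n ≤ 1 - (n : ℝ) ^ (-c)

/-- `F` is a strongly one-way function. -/
def IsStronglyOneWay (F : BitStr → BitStr) : Prop :=
  PolyTime F ∧ ∀ c : ℝ, 0 < c → ∀ G : PPT, ∀ᶠ n : ℕ in Filter.atTop, invertProb F G n ≤ (n : ℝ) ^ (-c)

/-- `F` restricts, for every `n`, to a bijection of `{0,1}ⁿ` onto itself. -/
def IsLengthPreservingPerm (F : BitStr → BitStr) : Prop :=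
  ∀ n : ℕ, Set.BijOn F {x | x.length = n} {x | x.length = n}

/-- `F` is a weakly one-way permutation. -/
def IsWeaklyOneWayPerm (F : BitStr → BitStr) : Prop :=
  IsWeaklyOneWay F ∧ IsLengthPreservingPerm F

/-- `F` is a strongly one-way permutation. -/
def IsStronglyOneWayPerm (F : BitStr → BitStr) : Prop :=
  IsStronglyOneWay F ∧ IsLengthPreservingPerm F

end OneWay

/-!
If a weakly one-way function `F` exists, the direct product of `F` with itself over polynomially
many blocks is strongly one-way. Let `1 - n ^ (-c)` bound the success of every algorithm against
`F`, and let `a` be a natural number with `c ≤ a`. The function `amplify a Φ`, with `Φ = E ∘ F`,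
cuts a string of length `N` into `n ^ (a + 1)` blocks of length `n = root (a + 2) N` and a
remainder, and applies `Φ` to each of the blocks. The code `E` makes the images of the blocks
readable from their concatenation (`Decodable`): it is the self-delimiting code `dbl` in general,
and the identity if `F` is a length-preserving permutation, in which case `amplify a F` is one as
well.

*The reduction.* Let `G` invert the amplified function with probability `δ > N ^ (-c')` for
infinitely many `N`. Given `y = F x` with `|x| = n`, plant `E y` as the `i`-th block of a random
value of the amplified function, apply `G`, and return the `i`-th block of the answer if it is a
preimage of `y` (`trial`). The reduction does this for all lengths `N < (n + 1) ^ (a + 2)`, all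
positions `i` and many independent random strings. A result is always correct, so that the failure
probability can be estimated with the good length `N` alone. Call `x` bad if every position `i`
gives success probability at most `ε = δ / (2 n ^ (a + 1))`, and let `β` be the probability of the
bad strings. As the blocks are independent, `δ ≤ (1 - β) ^ (n ^ (a + 1)) + n ^ (a + 1) ε`
(`avg_le_of_bad`), which forces `β < 1 / (2 n ^ a)`. For `x` not bad, the repetitions fail only
with probability `(1 - ε) ^ T ≤ exp (-n)`. Hence the reduction inverts `F` with probability more
than `1 - n ^ (-a) ≥ 1 - n ^ (-c)` for arbitrarily large `n` (`exists_bad_prob`,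
`bad_prob_add_lt`), a contradiction.

*Polynomial time.* The amplified function and the reduction have to be computed by multi-stack
machines in polynomial time. Machines are translated into machines with more stacks, more internal
states and other labels (`transStmt`), which makes them available as subroutines of one another.
The class `PT` of functions computable in polynomial time between types encoded by bit strings is
closed under composition, pairing, case distinction and iteration with states of polynomial size
(`PT.iterate`), and contains all the functions computed by finite automata with output
(`PT.transduce`). The amplified function and the reduction are built from these operations.
-/

open Turing Function Polynomial

namespace OneWay

/-! ### Stack machines and their runs -/

section Machines

variable {K K' : Type} {Γ : K → Type} {Γ' : K' → Type} {Λ Λ' σ σ' τ : Type}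

/-- `Steps code t c c'`: the program `code` leads from the configuration `c` to `c'` in exactly
`t` steps. -/
inductive Steps [DecidableEq K] (code : Λ → TM2.Stmt Γ Λ σ) :
    ℕ → TM2.Cfg Γ Λ σ → TM2.Cfg Γ Λ σ → Prop
  | refl (c) : Steps code 0 c c
  | head {l v S c t} : Steps code t (TM2.stepAux (code l) v S) c →
      Steps code (t + 1) ⟨some l, v, S⟩ c

theorem Steps.trans [DecidableEq K] {code : Λ → TM2.Stmt Γ Λ σ} {t t' : ℕ}
    {c c' c'' : TM2.Cfg Γ Λ σ} (h : Steps code t c c') (h' : Steps code t' c' c'') :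
    Steps code (t + t') c c'' := by
  induction h with
  | refl c => simpa using h'
  | head _ ih => rw [Nat.add_right_comm]; exact .head (ih h')

theorem steps_iff_iterate [DecidableEq K] {code : Λ → TM2.Stmt Γ Λ σ} {t : ℕ}
    {c c' : TM2.Cfg Γ Λ σ} :
    Steps code t c c' ↔ (flip bind (TM2.step code))^[t] (some c) = some c' := by
  have hnone : ∀ t : ℕ, (flip bind (TM2.step code))^[t] none = none := fun t =>
    Function.iterate_fixed rfl t
  induction t generalizing c with
  | zero =>
    constructor
    · intro h; cases h; rfl
    · intro h; cases h; exact .refl _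
  | succ t ih =>
    rw [Function.iterate_succ_apply]
    obtain ⟨_ | l, v, S⟩ := c
    · constructor
      · intro h; cases h
      · intro h
        have : flip bind (TM2.step code) (some ⟨none, v, S⟩) = none := rfl
        rw [this, hnone] at h
        cases h
    · have : flip bind (TM2.step code) (some ⟨some l, v, S⟩) =
        some (TM2.stepAux (code l) v S) := rfl
      rw [this]
      constructor
      · intro h; cases h with | head h => exact ih.1 h
      · exact fun h => .head (ih.2 h)

/-- A stack machine over the family `Γ` of stack alphabets. Its run begins and ends in the internal
state `init`, so that machines can be used as subroutines of one another. -/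
structure Mach (Γ : K → Type) where
  /-- the labels -/
  Λ : Type
  [fintypeΛ : Fintype Λ]
  /-- the first label -/
  start : Λ
  /-- the internal states -/
  σ : Type
  [fintypeσ : Fintype σ]
  /-- the internal state at the beginning and at the end of a run -/
  init : σ
  /-- the program -/
  code : Λ → TM2.Stmt Γ Λ σ

attribute [instance] Mach.fintypeΛ Mach.fintypeσ

/-- The machine `M` halts after exactly `t` steps, having turned the contents `S` of the stacks
into `S'` and having restored its internal state. -/
def Mach.Runs [DecidableEq K] (M : Mach Γ) (S S' : ∀ k, List (Γ k)) (t : ℕ) : Prop :=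
  Steps M.code t ⟨some M.start, M.init, S⟩ ⟨none, M.init, S'⟩

/-- An embedding of a family of stacks into another one. -/
structure StkEmb (Γ : K → Type) (Γ' : K' → Type) where
  /-- the stack that takes the place of a given one -/
  toFun : K → K'
  inj : Injective toFun
  /-- the identification of the alphabets -/
  eqv : ∀ k, Γ k ≃ Γ' (toFun k)

/-- The identity embedding. -/
def StkEmb.refl (Γ : K → Type) : StkEmb Γ Γ := ⟨id, injective_id, fun _ => Equiv.refl _⟩

/-- The stacks `T` hold a copy of `S` in the range of the embedding `E`, and agree with `F`
elsewhere. -/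
structure StkEmb.Rel (E : StkEmb Γ Γ') (F : ∀ k, List (Γ' k)) (S : ∀ k, List (Γ k))
    (T : ∀ k, List (Γ' k)) : Prop where
  eq_on : ∀ k, T (E.toFun k) = (S k).map (E.eqv k)
  eq_off : ∀ k', (∀ k, E.toFun k ≠ k') → T k' = F k'

theorem StkEmb.Rel.unique {E : StkEmb Γ Γ'} {F : ∀ k, List (Γ' k)} {S : ∀ k, List (Γ k)}
    {T T' : ∀ k, List (Γ' k)} (h : E.Rel F S T) (h' : E.Rel F S T') : T = T' := by
  funext k'
  by_cases hk : ∃ k, E.toFun k = k'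
  · obtain ⟨k, rfl⟩ := hk
    rw [h.eq_on, h'.eq_on]
  · push Not at hk
    rw [h.eq_off _ hk, h'.eq_off _ hk]

theorem StkEmb.Rel.update [DecidableEq K] [DecidableEq K'] {E : StkEmb Γ Γ'}
    {F : ∀ k, List (Γ' k)} {S : ∀ k, List (Γ k)} {T : ∀ k, List (Γ' k)} (h : E.Rel F S T) (k : K)
    (L : List (Γ k)) (L' : List (Γ' (E.toFun k))) (hL : L' = L.map (E.eqv k)) :
    E.Rel F (update S k L) (update T (E.toFun k) L') where
  eq_on j := by
    by_cases hj : j = k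
    · subst hj; simp [hL]
    · rw [update_of_ne (E.inj.ne hj), update_of_ne hj, h.eq_on]
  eq_off j hj := by rw [update_of_ne (hj k).symm, h.eq_off _ hj]

theorem StkEmb.Rel.refl (F S : ∀ k, List (Γ k)) : (StkEmb.refl Γ).Rel F S S where
  eq_on k := (List.map_id (S k)).symm
  eq_off k hk := absurd rfl (hk k)

/-- The translation of a statement along an embedding `E` of the stacks, an identification `φ` of
the internal states of the new machine with pairs whose first component is an internal state of the
old one, and a map `f` of the labels; the new machine goes to the label `x` where the old one
halts. -/
def transStmt (E : StkEmb Γ Γ') (φ : σ' ≃ σ × τ) (f : Λ → Λ') (x : Option Λ') :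
    TM2.Stmt Γ Λ σ → TM2.Stmt Γ' Λ' σ'
  | .push k g q => .push (E.toFun k) (fun v => E.eqv k (g (φ v).1)) (transStmt E φ f x q)
  | .peek k g q => .peek (E.toFun k)
      (fun v a => φ.symm (g (φ v).1 (a.map (E.eqv k).symm), (φ v).2)) (transStmt E φ f x q)
  | .pop k g q => .pop (E.toFun k)
      (fun v a => φ.symm (g (φ v).1 (a.map (E.eqv k).symm), (φ v).2)) (transStmt E φ f x q)
  | .load g q => .load (fun v => φ.symm (g (φ v).1, (φ v).2)) (transStmt E φ f x q)
  | .branch g q q' => .branch (fun v => g (φ v).1) (transStmt E φ f x q) (transStmt E φ f x q')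
  | .goto g => .goto (fun v => f (g (φ v).1))
  | .halt => x.elim .halt (fun l => .goto (fun _ => l))

/-- A translated statement acts on the copies of the stacks as the original one does, and touches
neither the other stacks nor the second component `w` of the internal state. -/
theorem stepAux_transStmt [DecidableEq K] [DecidableEq K'] (E : StkEmb Γ Γ') (φ : σ' ≃ σ × τ)
    (f : Λ → Λ') (x : Option Λ') (F : ∀ k, List (Γ' k)) (w : τ) (q : TM2.Stmt Γ Λ σ) (v : σ)
    (S : ∀ k, List (Γ k)) (T : ∀ k, List (Γ' k)) (h : E.Rel F S T) :
    ∃ T', E.Rel F (TM2.stepAux q v S).stk T' ∧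
      TM2.stepAux (transStmt E φ f x q) (φ.symm (v, w)) T =
        ⟨(TM2.stepAux q v S).l.elim x (fun l => some (f l)),
          φ.symm ((TM2.stepAux q v S).var, w), T'⟩ := by
  induction q generalizing v S T with
  | push k g q ih =>
    simp only [transStmt, TM2.stepAux, Equiv.apply_symm_apply]
    exact ih _ _ _ (h.update k _ _ (by simp [h.eq_on]))
  | peek k g q ih =>
    simp only [transStmt, TM2.stepAux, Equiv.apply_symm_apply]
    have : ((T (E.toFun k)).head?.map (E.eqv k).symm) = (S k).head? := by
      rw [h.eq_on]; cases S k <;> simp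
    rw [this]
    exact ih _ _ _ h
  | pop k g q ih =>
    simp only [transStmt, TM2.stepAux, Equiv.apply_symm_apply]
    have : ((T (E.toFun k)).head?.map (E.eqv k).symm) = (S k).head? := by
      rw [h.eq_on]; cases S k <;> simp
    rw [this]
    exact ih _ _ _ (h.update k _ _ (by simp [h.eq_on]))
  | load g q ih =>
    simp only [transStmt, TM2.stepAux, Equiv.apply_symm_apply]
    exact ih _ _ _ h
  | branch g q q' ih ih' =>
    simp only [transStmt, TM2.stepAux, Equiv.apply_symm_apply]
    cases g v
    · exact ih' _ _ _ h
    · exact ih _ _ _ h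
  | goto g => exact ⟨T, h, by simp [transStmt, TM2.stepAux]⟩
  | halt => exact ⟨T, h, by cases x <;> simp [transStmt, TM2.stepAux]⟩

/-- A run of a machine is a run of any machine that contains a translation of it. -/
theorem Mach.Runs.trans_steps [DecidableEq K] [DecidableEq K'] {M : Mach Γ}
    {S S' : ∀ k, List (Γ k)} {t : ℕ} (h : M.Runs S S' t) (E : StkEmb Γ Γ') (φ : σ' ≃ M.σ × τ)
    (f : M.Λ → Λ') (x : Option Λ') (code' : Λ' → TM2.Stmt Γ' Λ' σ')
    (hc : ∀ l, code' (f l) = transStmt E φ f x (M.code l)) (w : τ) {F T T' : ∀ k, List (Γ' k)}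
    (hT : E.Rel F S T) (hT' : E.Rel F S' T') :
    Steps code' t ⟨some (f M.start), φ.symm (M.init, w), T⟩ ⟨x, φ.symm (M.init, w), T'⟩ := by
  have key : ∀ t c c', Steps M.code t c c' → ∀ T, E.Rel F c.stk T → ∃ T', E.Rel F c'.stk T' ∧
      Steps code' t ⟨c.l.elim x (fun l => some (f l)), φ.symm (c.var, w), T⟩
        ⟨c'.l.elim x (fun l => some (f l)), φ.symm (c'.var, w), T'⟩ := by
    intro t c c' h
    induction h with
    | refl c => exact fun T hT => ⟨T, hT, .refl _⟩
    | @head l v S c t _ ih =>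
      intro T hT
      obtain ⟨T₁, h₁, e₁⟩ := stepAux_transStmt E φ f x F w (M.code l) v S T hT
      obtain ⟨T₂, h₂, e₂⟩ := ih T₁ h₁
      refine ⟨T₂, h₂, .head ?_⟩
      rw [hc, e₁]
      exact e₂
  obtain ⟨T₁, h₁, h₂⟩ := key _ _ _ h T hT
  rw [hT'.unique h₁]
  exact h₂

/-! ### Control structures -/

/-- The machine `M`, working on the stacks of a larger family. -/
def Mach.embed (M : Mach Γ) (E : StkEmb Γ Γ') : Mach Γ' where
  Λ := M.Λ
  start := M.start
  σ := M.σ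
  init := M.init
  code l := transStmt E (Equiv.prodPUnit M.σ).symm id none (M.code l)

theorem Mach.Runs.embed [DecidableEq K] [DecidableEq K'] {M : Mach Γ} {S S' : ∀ k, List (Γ k)}
    {t : ℕ} (h : M.Runs S S' t) (E : StkEmb Γ Γ') {T T' : ∀ k, List (Γ' k)}
    (hT : ∀ k, T (E.toFun k) = (S k).map (E.eqv k))
    (hT' : ∀ k, T' (E.toFun k) = (S' k).map (E.eqv k))
    (hoff : ∀ k', (∀ k, E.toFun k ≠ k') → T' k' = T k') :
    (M.embed E).Runs T T' t :=
  h.trans_steps E (Equiv.prodPUnit M.σ).symm id none (M.embed E).code (fun _ => rfl) ⟨⟩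
    (F := T) ⟨hT, fun _ _ => rfl⟩ ⟨hT', hoff⟩

/-- First `M₁`, then `M₂`. -/
def Mach.seq (M₁ M₂ : Mach Γ) : Mach Γ where
  Λ := M₁.Λ ⊕ M₂.Λ
  start := .inl M₁.start
  σ := M₁.σ × M₂.σ
  init := (M₁.init, M₂.init)
  code
    | .inl l => transStmt (.refl Γ) (Equiv.refl _) Sum.inl (some (.inr M₂.start)) (M₁.code l)
    | .inr l => transStmt (.refl Γ) (Equiv.prodComm _ _) Sum.inr none (M₂.code l)

theorem Mach.Runs.seq [DecidableEq K] {M₁ M₂ : Mach Γ} {S S' S'' : ∀ k, List (Γ k)} {t t' : ℕ}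
    (h : M₁.Runs S S' t) (h' : M₂.Runs S' S'' t') : (M₁.seq M₂).Runs S S'' (t + t') :=
  (h.trans_steps (.refl Γ) (Equiv.refl _) Sum.inl (some (.inr M₂.start)) (M₁.seq M₂).code
    (fun _ => rfl) M₂.init (.refl S S) (.refl S S')).trans
  (h'.trans_steps (.refl Γ) (Equiv.prodComm _ _) Sum.inr none (M₁.seq M₂).code
    (fun _ => rfl) M₁.init (.refl S S') (.refl S S''))

/-- The machine that runs `M₁` if the top of the stack `k` passes the test `p`, and `M₂`
otherwise. -/
def Mach.ite (k : K) (p : Option (Γ k) → Bool) (M₁ M₂ : Mach Γ) : Mach Γ where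
  Λ := Option (M₁.Λ ⊕ M₂.Λ)
  start := none
  σ := (M₁.σ × M₂.σ) × Bool
  init := ((M₁.init, M₂.init), false)
  code
    | none => .peek k (fun v a => (v.1, p a)) <| .branch (fun v => v.2)
        (.load (fun v => (v.1, false)) (.goto fun _ => some (.inl M₁.start)))
        (.load (fun v => (v.1, false)) (.goto fun _ => some (.inr M₂.start)))
    | some (.inl l) =>
      transStmt (.refl Γ) (Equiv.prodAssoc _ _ _) (fun l => some (.inl l)) none (M₁.code l)
    | some (.inr l) =>
      transStmt (.refl Γ) (((Equiv.prodComm _ _).prodCongr (Equiv.refl _)).trans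
        (Equiv.prodAssoc _ _ _)) (fun l => some (.inr l)) none (M₂.code l)

theorem Mach.Runs.ite_pos [DecidableEq K] {k : K} {p : Option (Γ k) → Bool} {M₁ M₂ : Mach Γ}
    {S S' : ∀ k, List (Γ k)} {t : ℕ} (h : M₁.Runs S S' t) (hp : p (S k).head? = true) :
    (Mach.ite k p M₁ M₂).Runs S S' (t + 1) := by
  refine .head ?_
  simp only [Mach.ite, TM2.stepAux, hp, cond_true]
  exact h.trans_steps (.refl Γ) (Equiv.prodAssoc _ _ _) (fun l => some (.inl l)) none
    (Mach.ite k p M₁ M₂).code (fun _ => rfl) (M₂.init, false) (.refl S S) (.refl S S')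

theorem Mach.Runs.ite_neg [DecidableEq K] {k : K} {p : Option (Γ k) → Bool} {M₁ M₂ : Mach Γ}
    {S S' : ∀ k, List (Γ k)} {t : ℕ} (h : M₂.Runs S S' t) (hp : p (S k).head? = false) :
    (Mach.ite k p M₁ M₂).Runs S S' (t + 1) := by
  refine .head ?_
  simp only [Mach.ite, TM2.stepAux, hp, cond_false]
  exact h.trans_steps (.refl Γ) (((Equiv.prodComm _ _).prodCongr (Equiv.refl _)).trans
        (Equiv.prodAssoc _ _ _)) (fun l => some (.inr l)) none
    (Mach.ite k p M₁ M₂).code (fun _ => rfl) (M₁.init, false) (.refl S S) (.refl S S')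

/-- The machine that repeats `M` as long as the top of the stack `k` passes the test `p`. -/
def Mach.loop (k : K) (p : Option (Γ k) → Bool) (M : Mach Γ) : Mach Γ where
  Λ := Option M.Λ
  start := none
  σ := M.σ × Bool
  init := (M.init, false)
  code
    | none => .peek k (fun v a => (v.1, p a)) <| .branch (fun v => v.2)
        (.load (fun v => (v.1, false)) (.goto fun _ => some M.start))
        (.load (fun v => (v.1, false)) .halt)
    | some l => transStmt (.refl Γ) (Equiv.refl _) some (some none) (M.code l)

theorem Mach.Runs.loop_stop [DecidableEq K] {k : K} {p : Option (Γ k) → Bool} {M : Mach Γ}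
    {S : ∀ k, List (Γ k)} (hp : p (S k).head? = false) : (Mach.loop k p M).Runs S S 1 := by
  refine .head ?_
  simp only [Mach.loop, TM2.stepAux, hp, cond_false]
  exact .refl _

theorem Mach.Runs.loop_step [DecidableEq K] {k : K} {p : Option (Γ k) → Bool} {M : Mach Γ}
    {S S' S'' : ∀ k, List (Γ k)} {t t' : ℕ} (hp : p (S k).head? = true) (h : M.Runs S S' t)
    (h' : (Mach.loop k p M).Runs S' S'' t') : (Mach.loop k p M).Runs S S'' (t + t' + 1) := by
  refine .head ?_
  simp only [Mach.loop, TM2.stepAux, hp, cond_true]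
  exact (h.trans_steps (.refl Γ) (Equiv.refl _) some (some none)
    (Mach.loop k p M).code (fun _ => rfl) false (.refl S S) (.refl S S')).trans h'

/-! ### Sweeping a stack -/

/-- The statement that pushes the symbols of `g v` (at most `n`) one by one on the stack `k`, then
does `q`; `b` is never pushed unless it belongs to `g v`. -/
def pushList (k : K) (b : Γ k) : ℕ → (σ → List (Γ k)) → TM2.Stmt Γ Λ σ → TM2.Stmt Γ Λ σ
  | 0, _, q => q
  | n + 1, g, q => .branch (fun v => (g v).isEmpty) q
      (.push k (fun v => (g v).headD b) (pushList k b n (fun v => (g v).tail) q))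

theorem stepAux_pushList [DecidableEq K] (k : K) (b : Γ k) (n : ℕ) (g : σ → List (Γ k))
    (q : TM2.Stmt Γ Λ σ) (v : σ) (S : ∀ k, List (Γ k)) (h : (g v).length ≤ n) :
    TM2.stepAux (pushList k b n g q) v S =
      TM2.stepAux q v (update S k ((g v).reverse ++ S k)) := by
  induction n generalizing g S with
  | zero =>
    have : g v = [] := List.length_eq_zero_iff.1 (Nat.le_zero.1 h)
    simp [pushList, this]
  | succ n ih =>
    rcases hg : g v with _ | ⟨a, l⟩
    · simp [pushList, hg]
    · simp only [pushList, TM2.stepAux, hg, List.isEmpty_cons, cond_false]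
      rw [ih]
      · simp [hg]
      · simpa [hg] using h

/-- The sweep of the stack `k`, controlled by a finite automaton with states `Q`: pop the symbols
of `k` one by one; on the symbol `a` in the state `s` push the symbols of `em s a` on the stack
`k'`, and when `k` is empty push those of `fin s`. No list has more than `n` symbols. -/
def Mach.sweep {Q : Type} [Fintype Q] (s₀ : Q) (k k' : K) [Fintype (Γ k)] (b : Γ k') (n : ℕ)
    (δ : Q → Γ k → Q) (em : Q → Γ k → List (Γ k')) (fin : Q → List (Γ k')) : Mach Γ where
  Λ := Unit
  start := ()
  σ := Q × Option (Γ k)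
  init := (s₀, none)
  code _ := .pop k (fun v a => (v.1, a)) <| .branch (fun v => v.2.isNone)
    (pushList k' b n (fun v => fin v.1) (.load (fun _ => (s₀, none)) .halt))
    (pushList k' b n (fun v => v.2.elim [] (em v.1))
      (.load (fun v => (v.2.elim v.1 (δ v.1), none)) (.goto fun _ => ())))

/-- The output of a finite automaton with output. -/
def transduce {Q A B : Type} (δ : Q → A → Q) (em : Q → A → List B) (fin : Q → List B) :
    Q → List A → List B
  | s, [] => fin s
  | s, a :: l => em s a ++ transduce δ em fin (δ s a) l

/-- The output of the automaton arrives on the stack `k'` in reversed order. -/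
theorem Mach.runs_sweep [DecidableEq K] {Q : Type} [Fintype Q] (s₀ : Q) {k k' : K}
    [Fintype (Γ k)] (b : Γ k') (n : ℕ) (δ : Q → Γ k → Q) (em : Q → Γ k → List (Γ k'))
    (fin : Q → List (Γ k')) (hk : k' ≠ k) (hem : ∀ s a, (em s a).length ≤ n)
    (hfin : ∀ s, (fin s).length ≤ n) (S : ∀ k, List (Γ k)) :
    (Mach.sweep s₀ k k' b n δ em fin).Runs S
      (update (update S k []) k' ((transduce δ em fin s₀ (S k)).reverse ++ S k'))
      ((S k).length + 1) := by
  have key : ∀ (l : List (Γ k)) (s : Q) (S : ∀ k, List (Γ k)), S k = l →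
      Steps (Mach.sweep s₀ k k' b n δ em fin).code (l.length + 1) ⟨some (), (s, none), S⟩
        ⟨none, (s₀, none),
          update (update S k []) k' ((transduce δ em fin s l).reverse ++ S k')⟩ := by
    intro l
    induction l with
    | nil =>
      intro s S hS
      refine .head ?_
      simp only [Mach.sweep, TM2.stepAux, hS, List.head?_nil, Option.isNone_none, cond_true,
        List.tail_nil]
      rw [stepAux_pushList _ _ _ _ _ (s, none) _ (by exact hfin s)]
      simp only [TM2.stepAux, transduce, update_of_ne hk]
      exact .refl _
    | cons a l ih =>
      intro s S hS
      refine .head ?_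
      simp only [Mach.sweep, TM2.stepAux, hS, List.head?_cons, Option.isNone_some, cond_false,
        List.tail_cons]
      rw [stepAux_pushList _ _ _ _ _ (s, some a) _ (by exact hem s a)]
      simp only [TM2.stepAux, Option.elim, update_of_ne hk]
      have := ih (δ s a) (update (update S k l) k' ((em s a).reverse ++ S k'))
        (by rw [update_of_ne hk.symm, update_self])
      have e : update (update (update (update S k l) k' ((em s a).reverse ++ S k')) k []) k'
          ((transduce δ em fin (δ s a) l).reverse ++
            update (update S k l) k' ((em s a).reverse ++ S k') k') =
          update (update S k []) k' ((transduce δ em fin s (a :: l)).reverse ++ S k') := by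
        funext j
        by_cases hj : j = k'
        · subst hj; simp [transduce]
        · by_cases hj' : j = k
          · subst hj'; simp [update_of_ne hj]
          · simp [hj, hj']
      rw [e] at this
      exact this
  exact key _ _ _ rfl

/-! ### The contents of the stacks grow at most linearly with time -/

/-- The number of push instructions of a statement. -/
def pushCount : TM2.Stmt Γ Λ σ → ℕ
  | .push _ _ q => pushCount q + 1
  | .peek _ _ q => pushCount q
  | .pop _ _ q => pushCount q
  | .load _ q => pushCount q
  | .branch _ q q' => pushCount q + pushCount q'
  | .goto _ => 0
  | .halt => 0

theorem stepAux_length_le [DecidableEq K] (q : TM2.Stmt Γ Λ σ) (v : σ) (S : ∀ k, List (Γ k))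
    (n : ℕ) (hn : ∀ k, (S k).length ≤ n) (k : K) :
    ((TM2.stepAux q v S).stk k).length ≤ n + pushCount q := by
  induction q generalizing v S n with
  | push j g q ih =>
    simp only [TM2.stepAux, pushCount]
    refine (ih _ _ (n + 1) ?_).trans (by lia)
    intro i
    by_cases hi : i = j
    · subst hi; simp [hn]
    · rw [update_of_ne hi]; exact (hn i).trans (Nat.le_succ n)
  | peek j g q ih => exact ih _ _ n hn
  | pop j g q ih =>
    refine ih _ _ n ?_
    intro i
    by_cases hi : i = j
    · subst hi; simp only [update_self, List.length_tail]; exact (Nat.sub_le _ _).trans (hn i)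
    · rw [update_of_ne hi]; exact hn i
  | load g q ih => exact ih _ _ n hn
  | branch g q q' ih ih' =>
    simp only [TM2.stepAux, pushCount]
    cases g v
    · exact (ih' _ _ n hn).trans (by lia)
    · exact (ih _ _ n hn).trans (by lia)
  | goto g => exact hn k
  | halt => exact hn k

theorem Mach.Runs.length_le [DecidableEq K] {M : Mach Γ} {S S' : ∀ k, List (Γ k)} {t n : ℕ}
    (h : M.Runs S S' t) (hn : ∀ k, (S k).length ≤ n) (k : K) :
    (S' k).length ≤ n + t * ∑ l, pushCount (M.code l) := by
  have key : ∀ t c c', Steps M.code t c c' → ∀ n, (∀ k, (c.stk k).length ≤ n) →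
      (c'.stk k).length ≤ n + t * ∑ l, pushCount (M.code l) := by
    intro t c c' h
    induction h with
    | refl c => intro n hn; simpa using hn k
    | @head l v S c t _ ih =>
      intro n hn
      refine (ih _ fun k => (stepAux_length_le (M.code l) v S n hn k)).trans ?_
      have : pushCount (M.code l) ≤ ∑ l, pushCount (M.code l) :=
        Finset.single_le_sum (f := fun l => pushCount (M.code l)) (fun _ _ => Nat.zero_le _)
          (Finset.mem_univ l)
      rw [Nat.succ_mul]
      lia
  exact key _ _ _ h n hn

end Machines

/-! ### Machines with an input stack and an output stack -/

section FunctionMachines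

theorem Mach.runs_sweep_of_eq {K : Type} {Γ : K → Type} [DecidableEq K] {Q : Type} [Fintype Q]
    (s₀ : Q) {k k' : K} [Fintype (Γ k)] (b : Γ k') (n : ℕ) (δ : Q → Γ k → Q)
    (em : Q → Γ k → List (Γ k')) (fin : Q → List (Γ k')) (hk : k' ≠ k)
    (hem : ∀ s a, (em s a).length ≤ n) (hfin : ∀ s, (fin s).length ≤ n)
    {S S' : ∀ k, List (Γ k)} (h : S' k = [])
    (h' : S' k' = (transduce δ em fin s₀ (S k)).reverse ++ S k')
    (h'' : ∀ j, j ≠ k → j ≠ k' → S' j = S j) :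
    (Mach.sweep s₀ k k' b n δ em fin).Runs S S' ((S k).length + 1) := by
  have := Mach.runs_sweep s₀ b n δ em fin hk hem hfin S
  convert this using 1
  funext j
  by_cases hj : j = k'
  · subst hj; simp [h']
  · by_cases hj' : j = k
    · subst hj'; simp [update_of_ne hj, h]
    · simp [hj, hj', h'']

theorem transduce_unit {A B : Type} (e : A → List B) (c : List B) (l : List A) :
    transduce (fun (_ : Unit) _ => ()) (fun _ => e) (fun _ => c) () l = l.flatMap e ++ c := by
  induction l with
  | nil => rfl
  | cons a l ih => simp [transduce, ih]

/-- Move the symbols of the stack `k` to the stack `k'`, translated by `e`; the order is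
reversed. -/
def Mach.move {K : Type} {Γ : K → Type} (k k' : K) [Fintype (Γ k)] (b : Γ k')
    (e : Γ k → Γ k') : Mach Γ :=
  .sweep () k k' b 1 (fun _ _ => ()) (fun _ a => [e a]) (fun _ => [])

theorem Mach.runs_move {K : Type} {Γ : K → Type} [DecidableEq K] {k k' : K} [Fintype (Γ k)]
    (b : Γ k') (e : Γ k → Γ k') (hk : k' ≠ k) {S S' : ∀ k, List (Γ k)} (h : S' k = [])
    (h' : S' k' = ((S k).map e).reverse ++ S k') (h'' : ∀ j, j ≠ k → j ≠ k' → S' j = S j) :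
    (Mach.move k k' b e).Runs S S' ((S k).length + 1) := by
  refine Mach.runs_sweep_of_eq () b 1 (fun _ _ => ()) (fun _ a => [e a]) (fun _ => []) hk
    (fun _ _ => le_rfl) (fun _ => Nat.zero_le 1) h ?_ h''
  rw [transduce_unit, h', List.append_nil, List.map_eq_flatMap]

/-- Move the symbols of the stack `k` to both stacks `k₁` and `k₂`; the order is reversed. -/
def Mach.dup {K : Type} {Γ : K → Type} (k k₁ k₂ : K) [Fintype (Γ k)] (b₁ : Γ k₁) (b₂ : Γ k₂)
    (e₁ : Γ k → Γ k₁) (e₂ : Γ k → Γ k₂) : Mach Γ where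
  Λ := Unit
  start := ()
  σ := Option (Γ k)
  init := none
  code _ := .pop k (fun _ a => a) <| .branch (fun v => v.isNone) .halt <|
    .push k₁ (fun v => v.elim b₁ e₁) <| .push k₂ (fun v => v.elim b₂ e₂) <|
    .load (fun _ => none) <| .goto fun _ => ()

theorem Mach.runs_dup {K : Type} {Γ : K → Type} [DecidableEq K] {k k₁ k₂ : K} [Fintype (Γ k)]
    (b₁ : Γ k₁) (b₂ : Γ k₂) (e₁ : Γ k → Γ k₁) (e₂ : Γ k → Γ k₂) (h₁ : k₁ ≠ k) (h₂ : k₂ ≠ k)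
    (h₁₂ : k₁ ≠ k₂) {S S' : ∀ k, List (Γ k)} (h : S' k = [])
    (hS₁ : S' k₁ = ((S k).map e₁).reverse ++ S k₁) (hS₂ : S' k₂ = ((S k).map e₂).reverse ++ S k₂)
    (hoff : ∀ j, j ≠ k → j ≠ k₁ → j ≠ k₂ → S' j = S j) :
    (Mach.dup k k₁ k₂ b₁ b₂ e₁ e₂).Runs S S' ((S k).length + 1) := by
  have key : ∀ (l : List (Γ k)) (S : ∀ k, List (Γ k)), S k = l →
      S' k₁ = (l.map e₁).reverse ++ S k₁ → S' k₂ = (l.map e₂).reverse ++ S k₂ →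
      (∀ j, j ≠ k → j ≠ k₁ → j ≠ k₂ → S' j = S j) →
      Steps (Mach.dup k k₁ k₂ b₁ b₂ e₁ e₂).code (l.length + 1) ⟨some (), none, S⟩
        ⟨none, none, S'⟩ := by
    intro l
    induction l with
    | nil =>
      intro S hS g₁ g₂ g
      refine .head ?_
      simp only [Mach.dup, TM2.stepAux, hS, List.head?_nil, Option.isNone_none, cond_true,
        List.tail_nil]
      have : update S k [] = S' := by
        funext j
        by_cases hj : j = k
        · subst hj; simp [h]
        by_cases hj₁ : j = k₁
        · subst hj₁; simp [hj, g₁]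
        by_cases hj₂ : j = k₂
        · subst hj₂; simp [hj, g₂]
        simp [hj, g j hj hj₁ hj₂]
      rw [this]
      exact .refl _
    | cons a l ih =>
      intro S hS g₁ g₂ g
      refine .head ?_
      simp only [Mach.dup, TM2.stepAux, hS, List.head?_cons, Option.isNone_some, cond_false,
        List.tail_cons, Option.elim]
      refine ih _ ?_ ?_ ?_ ?_
      · simp [h₁.symm, h₂.symm]
      · simp [h₁, h₁₂, g₁]
      · simp [h₁₂.symm, h₂, g₂]
      · intro j hj hj₁ hj₂
        simp [hj, hj₁, hj₂, g j hj hj₁ hj₂]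
  exact key _ S rfl hS₁ hS₂ hoff

variable {A B C : Type}

/-- The stack alphabets of a machine with input alphabet `A`, output alphabet `B` and hidden stacks
with alphabets `Γ`. -/
@[reducible] def IOAlphabet (A B : Type) {H : Type} (Γ : H → Type) : Bool ⊕ H → Type
  | .inl false => A
  | .inl true => B
  | .inr h => Γ h

/-- The stacks with input `x`, output `y` and hidden part `z`. -/
def ioStk {H : Type} {Γ : H → Type} (x : List A) (y : List B) (z : ∀ h, List (Γ h)) :
    ∀ k, List (IOAlphabet A B Γ k)
  | .inl false => x
  | .inl true => y
  | .inr h => z h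

/-- A machine with an input stack, an output stack and finitely many hidden stacks. -/
structure FMach (A B : Type) where
  /-- the hidden stacks -/
  H : Type
  [fintypeH : Fintype H]
  [decidableEqH : DecidableEq H]
  /-- the alphabets of the hidden stacks -/
  Γ : H → Type
  /-- the machine -/
  M : Mach (IOAlphabet A B Γ)

attribute [instance] FMach.fintypeH FMach.decidableEqH

/-- The machine turns the input `x` into the output `y` within `t` steps, leaving all the other
stacks empty. -/
def FMach.Maps (M : FMach A B) (x : List A) (y : List B) (t : ℕ) : Prop :=
  ∃ t' ≤ t, M.M.Runs (ioStk x [] fun _ => []) (ioStk [] y fun _ => []) t'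

theorem FMach.Maps.mono {M : FMach A B} {x : List A} {y : List B} {t t' : ℕ} (h : M.Maps x y t)
    (ht : t ≤ t') : M.Maps x y t' :=
  let ⟨s, hs, hr⟩ := h
  ⟨s, hs.trans ht, hr⟩

/-- The length of the output grows at most linearly with the running time. -/
theorem FMach.exists_length_le (M : FMach A B) :
    ∃ c, ∀ x y t, M.Maps x y t → y.length ≤ x.length + t * c := by
  refine ⟨∑ l, pushCount (M.M.code l), fun x y t ⟨t', ht', h⟩ => ?_⟩
  refine (h.length_le (n := x.length) ?_ (.inl true)).trans
    (Nat.add_le_add_left (Nat.mul_le_mul_right _ ht') _)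
  rintro ((_ | _) | h)
  exacts [le_rfl, Nat.zero_le _, Nat.zero_le _]

/-- The hidden stacks of a composition: the intermediate result and the hidden stacks of the two
machines. -/
abbrev compAlphabet (M₁ : FMach A B) (M₂ : FMach B C) : Unit ⊕ M₁.H ⊕ M₂.H → Type
  | .inl _ => B
  | .inr (.inl h) => M₁.Γ h
  | .inr (.inr h) => M₂.Γ h

/-- The composition of two machines. -/
def FMach.comp (M₁ : FMach A B) (M₂ : FMach B C) : FMach A C where
  H := Unit ⊕ M₁.H ⊕ M₂.H
  Γ := compAlphabet M₁ M₂
  M := .seq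
    (M₁.M.embed
      { toFun
          | .inl false => .inl false
          | .inl true => .inr (.inl ())
          | .inr h => .inr (.inr (.inl h))
        inj := by rintro ((_ | _) | h) ((_ | _) | h') <;> simp
        eqv
          | .inl false => Equiv.refl A
          | .inl true => Equiv.refl B
          | .inr h => Equiv.refl (M₁.Γ h) })
    (M₂.M.embed
      { toFun
          | .inl false => .inr (.inl ())
          | .inl true => .inl true
          | .inr h => .inr (.inr (.inr h))
        inj := by rintro ((_ | _) | h) ((_ | _) | h') <;> simp
        eqv
          | .inl false => Equiv.refl B
          | .inl true => Equiv.refl C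
          | .inr h => Equiv.refl (M₂.Γ h) })

theorem FMach.Maps.comp {M₁ : FMach A B} {M₂ : FMach B C} {x : List A} {y : List B} {z : List C}
    {t t' : ℕ} (h : M₁.Maps x y t) (h' : M₂.Maps y z t') : (M₁.comp M₂).Maps x z (t + t') := by
  obtain ⟨s, hs, hr⟩ := h
  obtain ⟨s', hs', hr'⟩ := h'
  refine ⟨s + s', Nat.add_le_add hs hs', Mach.Runs.seq
    (S' := ioStk [] [] (fun | .inl _ => y | .inr (.inl _) => [] | .inr (.inr _) => []))
    (hr.embed _ ?_ ?_ ?_) (hr'.embed _ ?_ ?_ ?_)⟩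
  · rintro ((_ | _) | h)
    exacts [(List.map_id x).symm, rfl, rfl]
  · rintro ((_ | _) | h)
    exacts [rfl, (List.map_id y).symm, rfl]
  · rintro ((_ | _) | _ | h | h) hk
    exacts [absurd rfl (hk (.inl false)), rfl, absurd rfl (hk (.inl true)), rfl, rfl]
  · rintro ((_ | _) | h)
    exacts [(List.map_id y).symm, rfl, rfl]
  · rintro ((_ | _) | h)
    exacts [rfl, (List.map_id z).symm, rfl]
  · rintro ((_ | _) | _ | h | h) hk
    exacts [rfl, absurd rfl (hk (.inl true)), absurd rfl (hk (.inl false)), rfl, rfl]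

/-- The machine that applies a finite automaton with output. The sweep writes to a buffer in
reversed order, and the transfer to the output stack restores the order. -/
def FMach.transducer {Q : Type} [Fintype Q] [Fintype A] [Fintype B] (s₀ : Q) (b : B) (n : ℕ)
    (δ : Q → A → Q) (em : Q → A → List B) (fin : Q → List B) : FMach A B where
  H := Unit
  Γ _ := B
  M := .seq (.sweep (Γ := IOAlphabet A B _) s₀ (.inl false) (.inr ()) b n δ em fin)
    (.move (Γ := IOAlphabet A B _) (.inr ()) (.inl true) b (fun a => a))

theorem FMach.maps_transducer {Q : Type} [Fintype Q] [Fintype A] [Fintype B] (s₀ : Q) (b : B)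
    (n : ℕ) (δ : Q → A → Q) (em : Q → A → List B) (fin : Q → List B)
    (hem : ∀ s a, (em s a).length ≤ n) (hfin : ∀ s, (fin s).length ≤ n) (x : List A) :
    (FMach.transducer s₀ b n δ em fin).Maps x (transduce δ em fin s₀ x)
      ((x.length + 1) * (n + 1) + 1) := by
  have hl : ∀ (x : List A) (s : Q), (transduce δ em fin s x).length ≤ (x.length + 1) * n := by
    intro x
    induction x with
    | nil => intro s; simpa [transduce] using hfin s
    | cons a x ih =>
      intro s
      have h₁ := hem s a
      have h₂ := ih (δ s a)
      simp only [transduce, List.length_append, List.length_cons]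
      rw [Nat.succ_mul]
      lia
  refine ⟨_, ?_, Mach.Runs.seq (S' := ioStk [] [] (fun _ => (transduce δ em fin s₀ x).reverse))
    (Mach.runs_sweep_of_eq (Γ := IOAlphabet A B _) _ _ _ _ _ _ Sum.inr_ne_inl hem hfin rfl
      (List.append_nil _).symm ?_)
    (Mach.runs_move (Γ := IOAlphabet A B _) _ _ Sum.inl_ne_inr rfl ?_ ?_)⟩
  · have := hl x s₀
    change x.length + 1 + ((transduce δ em fin s₀ x).reverse.length + 1) ≤ _
    rw [Nat.mul_succ, List.length_reverse]
    lia
  · rintro ((_ | _) | _) h h'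
    exacts [absurd rfl h, rfl, absurd rfl h']
  · change transduce δ em fin s₀ x =
      (List.map (fun a => a) (transduce δ em fin s₀ x).reverse).reverse ++ []
    simp
  · rintro ((_ | _) | _) h h'
    exacts [rfl, absurd rfl h', absurd rfl h]

end FunctionMachines

section MachineConstructions

/-! ### Pairing, branching and looping machines -/

/-- The self-delimiting code of a bit string: `true` precedes each bit, and `false` ends the
code. -/
def dbl (x : BitStr) : BitStr := x.flatMap (fun b => [true, b]) ++ [false]

/-- The machine that pushes the symbol `b` on the stack `k`. -/
def Mach.push1 {K : Type} {Γ : K → Type} (k : K) (b : Γ k) : Mach Γ where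
  Λ := Unit
  start := ()
  σ := Unit
  init := ()
  code _ := .push k (fun _ => b) .halt

/-- The machine that removes the top of the stack `k`. -/
def Mach.pop1 {K : Type} {Γ : K → Type} (k : K) : Mach Γ where
  Λ := Unit
  start := ()
  σ := Unit
  init := ()
  code _ := .pop k (fun _ _ => ()) .halt

theorem Mach.runs_push1 {K : Type} {Γ : K → Type} [DecidableEq K] {k : K} (b : Γ k)
    {S S' : ∀ k, List (Γ k)} (h : S' k = b :: S k) (h' : ∀ j, j ≠ k → S' j = S j) :
    (Mach.push1 k b).Runs S S' 1 := by
  obtain rfl : S' = update S k (b :: S k) := by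
    funext j
    by_cases hj : j = k
    · subst hj; simp [h]
    · simp [hj, h']
  exact .head (.refl _)

theorem Mach.runs_pop1 {K : Type} {Γ : K → Type} [DecidableEq K] {k : K}
    {S S' : ∀ k, List (Γ k)} (h : S' k = (S k).tail) (h' : ∀ j, j ≠ k → S' j = S j) :
    (Mach.pop1 k : Mach Γ).Runs S S' 1 := by
  obtain rfl : S' = update S k (S k).tail := by
    funext j
    by_cases hj : j = k
    · subst hj; simp [h]
    · simp [hj, h']
  exact .head (.refl _)

/-- The auxiliary stacks of the pairing machine: a buffer, the inputs of the two machines, and the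
output of the first one. -/
inductive PairReg
  | tmp | inF | inG | outF
  deriving DecidableEq

instance : Fintype PairReg := ⟨{.tmp, .inF, .inG, .outF}, by rintro (_ | _ | _ | _) <;> simp⟩

/-- The alphabets of the hidden stacks of the pairing machine. -/
abbrev pairAlphabet (M₁ M₂ : FMach Bool Bool) : PairReg ⊕ M₁.H ⊕ M₂.H → Type
  | .inl _ => Bool
  | .inr (.inl h) => M₁.Γ h
  | .inr (.inr h) => M₂.Γ h

/-- The stacks of the pairing machine, with the stacks private to the two machines empty. -/
def pairStk (M₁ M₂ : FMach Bool Bool) (x y : BitStr) (r : PairReg → BitStr) :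
    ∀ k, List (IOAlphabet Bool Bool (pairAlphabet M₁ M₂) k)
  | .inl false => x
  | .inl true => y
  | .inr (.inl j) => r j
  | .inr (.inr (.inl _)) => []
  | .inr (.inr (.inr _)) => []

/-- The machine that applies `M₁` and `M₂` to the same input and outputs `dbl u ++ v`, where `u`
and `v` are their outputs. The output stack is filled from the bottom: first `v`, left there by
`M₂`, then the end marker `false` of `dbl u`, then the bits of `u`, each one below its marker
`true`. -/
def FMach.pair (M₁ M₂ : FMach Bool Bool) : FMach Bool Bool where
  H := PairReg ⊕ M₁.H ⊕ M₂.H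
  Γ := pairAlphabet M₁ M₂
  M := .seq (.move (Γ := IOAlphabet Bool Bool (pairAlphabet M₁ M₂))
      (.inl false) (.inr (.inl .tmp)) false (fun a => a)) <|
    .seq (.dup (Γ := IOAlphabet Bool Bool (pairAlphabet M₁ M₂)) (.inr (.inl .tmp))
      (.inr (.inl .inF)) (.inr (.inl .inG)) false false (fun a => a) (fun a => a)) <|
    .seq (M₁.M.embed
      { toFun
          | .inl false => .inr (.inl .inF)
          | .inl true => .inr (.inl .outF)
          | .inr h => .inr (.inr (.inl h))
        inj := by rintro ((_ | _) | h) ((_ | _) | h') <;> simp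
        eqv
          | .inl false => Equiv.refl Bool
          | .inl true => Equiv.refl Bool
          | .inr h => Equiv.refl (M₁.Γ h) }) <|
    .seq (M₂.M.embed
      { toFun
          | .inl false => .inr (.inl .inG)
          | .inl true => .inl true
          | .inr h => .inr (.inr (.inr h))
        inj := by rintro ((_ | _) | h) ((_ | _) | h') <;> simp
        eqv
          | .inl false => Equiv.refl Bool
          | .inl true => Equiv.refl Bool
          | .inr h => Equiv.refl (M₂.Γ h) }) <|
    .seq (.push1 (Γ := IOAlphabet Bool Bool (pairAlphabet M₁ M₂)) (.inl true) false) <|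
    .seq (.move (Γ := IOAlphabet Bool Bool (pairAlphabet M₁ M₂))
      (.inr (.inl .outF)) (.inr (.inl .tmp)) false (fun a => a))
    (.sweep (Γ := IOAlphabet Bool Bool (pairAlphabet M₁ M₂)) () (.inr (.inl .tmp)) (.inl true)
      false 2 (fun _ _ => ()) (fun _ b => [b, true]) (fun _ => []))

theorem flatMap_reverse_pair (u : BitStr) :
    (u.reverse.flatMap fun b => [b, true]).reverse = u.flatMap fun b => [true, b] := by
  induction u with
  | nil => rfl
  | cons a u ih => simp [List.flatMap_append, ih]

theorem FMach.Maps.pair {M₁ M₂ : FMach Bool Bool} {x u v : BitStr} {t t' : ℕ}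
    (h : M₁.Maps x u t) (h' : M₂.Maps x v t') :
    (M₁.pair M₂).Maps x (dbl u ++ v) (2 * x.length + 2 * u.length + t + t' + 5) := by
  obtain ⟨s, hs, hr⟩ := h
  obtain ⟨s', hs', hr'⟩ := h'
  refine ⟨(x.length + 1) + ((x.reverse.length + 1) + (s + (s' + (1 + ((u.length + 1) +
    (u.reverse.length + 1)))))), by simp only [List.length_reverse]; lia, ?_⟩
  have h_in : ∀ x : BitStr, ioStk x [] (fun _ => []) =
      pairStk M₁ M₂ x [] (fun _ => []) := by
    intro x; funext k; rcases k with (_ | _) | _ | _ | _ <;> rfl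
  have h_out : ∀ y : BitStr, ioStk [] y (fun _ => []) =
      pairStk M₁ M₂ [] y (fun _ => []) := by
    intro x; funext k; rcases k with (_ | _) | _ | _ | _ <;> rfl
  refine (congrArg₂ (fun a b => Mach.Runs (M₁.pair M₂).M a b _) (h_in x) (h_out _)).mpr ?_
  refine Mach.Runs.seq (S' := pairStk M₁ M₂ [] [] fun | .tmp => x.reverse | _ => [])
    (Mach.runs_move _ _ (by nofun) rfl ?_ ?_) <|
    Mach.Runs.seq (S' := pairStk M₁ M₂ [] [] fun | .inF => x | .inG => x | _ => [])
    (Mach.runs_dup _ _ _ _ (by nofun) (by nofun) (by nofun) rfl ?_ ?_ ?_) <|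
    Mach.Runs.seq (S' := pairStk M₁ M₂ [] [] fun | .outF => u | .inG => x | _ => [])
    (hr.embed _ ?_ ?_ ?_) <|
    Mach.Runs.seq (S' := pairStk M₁ M₂ [] v fun | .outF => u | _ => [])
    (hr'.embed _ ?_ ?_ ?_) <|
    Mach.Runs.seq (S' := pairStk M₁ M₂ [] (false :: v) fun | .outF => u | _ => [])
    (Mach.runs_push1 _ rfl ?_) <|
    Mach.Runs.seq (S' := pairStk M₁ M₂ [] (false :: v) fun | .tmp => u.reverse | _ => [])
    (Mach.runs_move _ _ (by nofun) rfl ?_ ?_)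
    (Mach.runs_sweep_of_eq (Γ := IOAlphabet Bool Bool (pairAlphabet M₁ M₂))
      (k := .inr (.inl .tmp)) (k' := .inl true) () _ _ (fun _ _ => ()) (fun _ b => [b, true])
      (fun _ => []) (by nofun) (fun _ _ => le_rfl) (fun _ => Nat.zero_le 2) rfl ?_ ?_)
  · change x.reverse = (x.map fun a => a).reverse ++ []
    simp
  · rintro ((_ | _) | (_ | _ | _ | _) | _ | _) h h'
    exacts [absurd rfl h, rfl, absurd rfl h', rfl, rfl, rfl, rfl, rfl]
  · change x = (x.reverse.map fun a => a).reverse ++ []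
    simp
  · change x = (x.reverse.map fun a => a).reverse ++ []
    simp
  · rintro ((_ | _) | (_ | _ | _ | _) | _ | _) h h' h''
    exacts [rfl, rfl, absurd rfl h, absurd rfl h', absurd rfl h'', rfl, rfl, rfl]
  · rintro ((_ | _) | h)
    exacts [(List.map_id x).symm, rfl, rfl]
  · rintro ((_ | _) | h)
    exacts [rfl, (List.map_id u).symm, rfl]
  · rintro ((_ | _) | (_ | _ | _ | _) | _ | _) h
    exacts [rfl, rfl, rfl, absurd rfl (h (.inl false)), rfl, absurd rfl (h (.inl true)), rfl, rfl]
  · rintro ((_ | _) | h)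
    exacts [(List.map_id x).symm, rfl, rfl]
  · rintro ((_ | _) | h)
    exacts [rfl, (List.map_id v).symm, rfl]
  · rintro ((_ | _) | (_ | _ | _ | _) | _ | _) h
    exacts [rfl, absurd rfl (h (.inl true)), rfl, rfl, absurd rfl (h (.inl false)), rfl, rfl, rfl]
  · rintro ((_ | _) | (_ | _ | _ | _) | _ | _) h
    exacts [rfl, absurd rfl h, rfl, rfl, rfl, rfl, rfl, rfl]
  · change u.reverse = (u.map fun a => a).reverse ++ []
    simp
  · rintro ((_ | _) | (_ | _ | _ | _) | _ | _) h h'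
    exacts [rfl, rfl, absurd rfl h', rfl, rfl, absurd rfl h, rfl, rfl]
  · change dbl u ++ v = (transduce (fun _ _ => ()) (fun _ b => [b, true]) (fun _ => []) ()
      u.reverse).reverse ++ false :: v
    rw [transduce_unit, List.append_nil, flatMap_reverse_pair]
    simp [dbl]
  · rintro ((_ | _) | (_ | _ | _ | _) | _ | _) h h'
    exacts [rfl, absurd rfl h', absurd rfl h, rfl, rfl, rfl, rfl, rfl]

/-- The alphabets of the hidden stacks of the branching machine. -/
abbrev branchAlphabet (M₁ M₂ : FMach Bool Bool) : M₁.H ⊕ M₂.H → Type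
  | .inl h => M₁.Γ h
  | .inr h => M₂.Γ h

/-- The machine that removes the first bit of its input and applies `M₁` or `M₂` to the rest,
according to this bit. -/
def FMach.branch (M₁ M₂ : FMach Bool Bool) : FMach Bool Bool where
  H := M₁.H ⊕ M₂.H
  Γ := branchAlphabet M₁ M₂
  M := .ite (Γ := IOAlphabet Bool Bool (branchAlphabet M₁ M₂)) (.inl false) (· == some true)
    (.seq (.pop1 (.inl false)) (M₁.M.embed
      { toFun
          | .inl b => .inl b
          | .inr h => .inr (.inl h)
        inj := by rintro (_ | h) (_ | h') <;> simp
        eqv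
          | .inl false => Equiv.refl Bool
          | .inl true => Equiv.refl Bool
          | .inr h => Equiv.refl (M₁.Γ h) }))
    (.seq (.pop1 (.inl false)) (M₂.M.embed
      { toFun
          | .inl b => .inl b
          | .inr h => .inr (.inr h)
        inj := by rintro (_ | h) (_ | h') <;> simp
        eqv
          | .inl false => Equiv.refl Bool
          | .inl true => Equiv.refl Bool
          | .inr h => Equiv.refl (M₂.Γ h) }))

theorem FMach.Maps.branch_true {M₁ : FMach Bool Bool} (M₂ : FMach Bool Bool) {x u : BitStr} {t : ℕ}
    (h : M₁.Maps x u t) : (M₁.branch M₂).Maps (true :: x) u (t + 2) := by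
  obtain ⟨s, hs, hr⟩ := h
  refine ⟨1 + s + 1, by lia, Mach.Runs.ite_pos (Mach.Runs.seq
    (S' := ioStk (Γ := branchAlphabet M₁ M₂) x [] fun _ => [])
    (Mach.runs_pop1 rfl ?_) (hr.embed _ ?_ ?_ ?_)) rfl⟩
  · rintro ((_ | _) | h) h'
    exacts [absurd rfl h', rfl, rfl]
  · rintro ((_ | _) | h)
    exacts [(List.map_id x).symm, rfl, rfl]
  · rintro ((_ | _) | h)
    exacts [rfl, (List.map_id u).symm, rfl]
  · rintro ((_ | _) | h | h) h'
    exacts [absurd rfl (h' (.inl false)), absurd rfl (h' (.inl true)), rfl, rfl]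

theorem FMach.Maps.branch_false (M₁ : FMach Bool Bool) {M₂ : FMach Bool Bool} {x u : BitStr}
    {t : ℕ} (h : M₂.Maps x u t) : (M₁.branch M₂).Maps (false :: x) u (t + 2) := by
  obtain ⟨s, hs, hr⟩ := h
  refine ⟨1 + s + 1, by lia, Mach.Runs.ite_neg (Mach.Runs.seq
    (S' := ioStk (Γ := branchAlphabet M₁ M₂) x [] fun _ => [])
    (Mach.runs_pop1 rfl ?_) (hr.embed _ ?_ ?_ ?_)) rfl⟩
  · rintro ((_ | _) | h) h'
    exacts [absurd rfl h', rfl, rfl]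
  · rintro ((_ | _) | h)
    exacts [(List.map_id x).symm, rfl, rfl]
  · rintro ((_ | _) | h)
    exacts [rfl, (List.map_id u).symm, rfl]
  · rintro ((_ | _) | h | h) h'
    exacts [absurd rfl (h' (.inl false)), absurd rfl (h' (.inl true)), rfl, rfl]

/-- The alphabets of the hidden stacks of the looping machine: a buffer, the output stack of `M`,
and the hidden stacks of `M`. -/
abbrev loopAlphabet (M : FMach Bool Bool) : Bool ⊕ M.H → Type
  | .inl _ => Bool
  | .inr h => M.Γ h

/-- One round of the looping machine: replace the contents of the input stack by the output of
`M`. -/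
def FMach.loopBody (M : FMach Bool Bool) : Mach (IOAlphabet Bool Bool (loopAlphabet M)) :=
  .seq (M.M.embed
      { toFun
          | .inl false => .inl false
          | .inl true => .inr (.inl true)
          | .inr h => .inr (.inr h)
        inj := by rintro ((_ | _) | h) ((_ | _) | h') <;> simp
        eqv
          | .inl false => Equiv.refl Bool
          | .inl true => Equiv.refl Bool
          | .inr h => Equiv.refl (M.Γ h) }) <|
    .seq (.move (Γ := IOAlphabet Bool Bool (loopAlphabet M))
      (.inr (.inl true)) (.inr (.inl false)) false (fun a => a))
    (.move (Γ := IOAlphabet Bool Bool (loopAlphabet M))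
      (.inr (.inl false)) (.inl false) false (fun a => a))

/-- The machine that applies `M` again and again, as long as the first bit is `true`. -/
def FMach.loop (M : FMach Bool Bool) : FMach Bool Bool where
  H := Bool ⊕ M.H
  Γ := loopAlphabet M
  M := .seq (.loop (.inl false) (· == some true) M.loopBody) <|
    .seq (.move (Γ := IOAlphabet Bool Bool (loopAlphabet M))
      (.inl false) (.inr (.inl false)) false (fun a => a))
    (.move (Γ := IOAlphabet Bool Bool (loopAlphabet M))
      (.inr (.inl false)) (.inl true) false (fun a => a))

theorem FMach.Maps.runs_loopBody {M : FMach Bool Bool} {x y : BitStr} {t : ℕ}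
    (h : M.Maps x y t) : ∃ t' ≤ t + 2 * y.length + 2, M.loopBody.Runs
      (ioStk x [] fun _ => []) (ioStk y [] fun _ => []) t' := by
  obtain ⟨s, hs, hr⟩ := h
  refine ⟨s + ((y.length + 1) + (y.reverse.length + 1)),
    by simp only [List.length_reverse]; lia, ?_⟩
  refine Mach.Runs.seq
    (S' := ioStk [] [] (fun | .inl false => [] | .inl true => y | .inr _ => []))
    (hr.embed _ ?_ ?_ ?_) <| Mach.Runs.seq
    (S' := ioStk [] [] (fun | .inl false => y.reverse | .inl true => [] | .inr _ => []))
    (Mach.runs_move _ _ (by nofun) rfl ?_ ?_) (Mach.runs_move _ _ (by nofun) rfl ?_ ?_)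
  · rintro ((_ | _) | h)
    exacts [(List.map_id x).symm, rfl, rfl]
  · rintro ((_ | _) | h)
    exacts [rfl, (List.map_id y).symm, rfl]
  · rintro ((_ | _) | (_ | _) | _) h
    exacts [absurd rfl (h (.inl false)), rfl, rfl, absurd rfl (h (.inl true)), rfl]
  · change y.reverse = (y.map fun a => a).reverse ++ []
    simp
  · rintro ((_ | _) | (_ | _) | _) h h'
    exacts [rfl, rfl, absurd rfl h', absurd rfl h, rfl]
  · change y = (y.reverse.map fun a => a).reverse ++ []
    simp
  · rintro ((_ | _) | (_ | _) | _) h h'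
    exacts [absurd rfl h', rfl, absurd rfl h, rfl, rfl]

theorem FMach.maps_loop {M : FMach Bool Bool} {x : ℕ → BitStr} {n t B : ℕ}
    (h : ∀ i < n, M.Maps (x i) (x (i + 1)) t) (hB : ∀ i ≤ n, (x i).length ≤ B)
    (hx : ∀ i < n, (x i).head? = some true) (hn : (x n).head? ≠ some true) :
    M.loop.Maps (x 0) (x n) ((n + 1) * (t + 2 * B + 3)) := by
  have key : ∀ j i, i + j = n → ∃ t' ≤ j * (t + 2 * B + 3) + 1,
      (Mach.loop (.inl false) (· == some true) M.loopBody).Runs (ioStk (x i) [] fun _ => [])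
        (ioStk (x n) [] fun _ => []) t' := by
    intro j
    induction j with
    | zero =>
      intro i hi
      obtain rfl : i = n := hi
      exact ⟨1, by lia, Mach.Runs.loop_stop (beq_eq_false_iff_ne.2 hn)⟩
    | succ j ih =>
      intro i hi
      obtain ⟨t₁, ht₁, h₁⟩ := ih (i + 1) (by lia)
      obtain ⟨t₂, ht₂, h₂⟩ := (h i (by lia)).runs_loopBody
      have := hB (i + 1) (by lia)
      refine ⟨t₂ + t₁ + 1, ?_, Mach.Runs.loop_step (beq_iff_eq.2 (hx i (by lia))) h₂ h₁⟩
      rw [Nat.succ_mul]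
      lia
  obtain ⟨t₁, ht₁, h₁⟩ := key n 0 (by lia)
  refine ⟨t₁ + (((x n).length + 1) + ((x n).reverse.length + 1)), ?_,
    h₁.seq (Mach.Runs.seq
      (S' := ioStk [] [] (fun | .inl false => (x n).reverse | .inl true => [] | .inr _ => []))
    (Mach.runs_move _ _ (by nofun) rfl ?_ ?_) (Mach.runs_move _ _ (by nofun) rfl ?_ ?_))⟩
  · have := hB n le_rfl
    rw [List.length_reverse, Nat.succ_mul]
    lia
  · change (x n).reverse = ((x n).map fun a => a).reverse ++ []
    simp
  · rintro ((_ | _) | (_ | _) | _) h h'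
    exacts [absurd rfl h, rfl, absurd rfl h', rfl, rfl]
  · change x n = ((x n).reverse.map fun a => a).reverse ++ []
    simp
  · rintro ((_ | _) | (_ | _) | _) h h'
    exacts [rfl, absurd rfl h', absurd rfl h, rfl, rfl]

/-! ### Comparison with Mathlib's machines -/

variable {A B : Type}

theorem initList_stk_self (tm : FinTM2) (s : List (tm.Γ tm.k₀)) :
    (initList tm s).stk tm.k₀ = s := by
  simp [initList]

theorem initList_stk_of_ne (tm : FinTM2) (s : List (tm.Γ tm.k₀)) {k : tm.K} (hk : k ≠ tm.k₀) :
    (initList tm s).stk k = [] := by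
  simp [initList, hk]

theorem haltList_stk_self (tm : FinTM2) (s : List (tm.Γ tm.k₁)) :
    (haltList tm s).stk tm.k₁ = s := by
  simp [haltList]

theorem haltList_stk_of_ne (tm : FinTM2) (s : List (tm.Γ tm.k₁)) {k : tm.K} (hk : k ≠ tm.k₁) :
    (haltList tm s).stk k = [] := by
  simp [haltList, hk]

/-- The machine underlying one of Mathlib's machines. -/
def machOfFinTM2 (tm : FinTM2) : Mach tm.Γ where
  Λ := tm.Λ
  fintypeΛ := tm.ΛFin
  start := tm.main
  σ := tm.σ
  fintypeσ := tm.σFin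
  init := tm.initialState
  code := tm.m

theorem runs_machOfFinTM2 {tm : FinTM2} {s : List (tm.Γ tm.k₀)} {s' : List (tm.Γ tm.k₁)} {t : ℕ}
    (h : TM2OutputsInTime tm s (some s') t) :
    ∃ t' ≤ t, (machOfFinTM2 tm).Runs (initList tm s).stk (haltList tm s').stk t' :=
  ⟨h.steps, h.steps_le_m, steps_iff_iterate.2 h.evals_in_steps⟩

/-- The hidden stacks of an imported machine: two buffers, and all the stacks of the machine. -/
abbrev importAlphabet (A B : Type) (tm : FinTM2) : Bool ⊕ tm.K → Type
  | .inl false => A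
  | .inl true => B
  | .inr k => tm.Γ k

/-- One of Mathlib's machines with its input and output moved to separate stacks; its own input and
output stacks may coincide. -/
noncomputable def FMach.ofFinTM2 [Fintype A] [Fintype B] [Inhabited A] [Inhabited B] (tm : FinTM2)
    (e₀ : tm.Γ tm.k₀ ≃ A) (e₁ : tm.Γ tm.k₁ ≃ B) : FMach A B :=
  letI := tm.kFin
  letI : Fintype (IOAlphabet A B (importAlphabet A B tm) (.inr (.inr tm.k₁))) :=
    Fintype.ofEquiv B e₁.symm
  { H := Bool ⊕ tm.K
    Γ := importAlphabet A B tm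
    M := .seq (.move (Γ := IOAlphabet A B (importAlphabet A B tm))
        (.inl false) (.inr (.inl false)) default (fun a => a)) <|
      .seq (.move (Γ := IOAlphabet A B (importAlphabet A B tm))
        (.inr (.inl false)) (.inr (.inr tm.k₀)) (e₀.symm default) (fun a => e₀.symm a)) <|
      .seq ((machOfFinTM2 tm).embed
        { toFun := fun k => .inr (.inr k)
          inj := fun k k' h => by simpa using h
          eqv := fun k => Equiv.refl (tm.Γ k) }) <|
      .seq (.move (Γ := IOAlphabet A B (importAlphabet A B tm))
        (.inr (.inr tm.k₁)) (.inr (.inl true)) default (fun a => e₁ a))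
      (.move (Γ := IOAlphabet A B (importAlphabet A B tm))
        (.inr (.inl true)) (.inl true) default (fun a => a)) }

theorem FMach.maps_ofFinTM2 [Fintype A] [Fintype B] [Inhabited A] [Inhabited B] {tm : FinTM2}
    (e₀ : tm.Γ tm.k₀ ≃ A) (e₁ : tm.Γ tm.k₁ ≃ B) {x : List A} {y : List B} {t : ℕ}
    (h : TM2OutputsInTime tm (x.map e₀.invFun) (some (y.map e₁.invFun)) t) :
    (FMach.ofFinTM2 tm e₀ e₁).Maps x y (2 * x.length + 2 * y.length + t + 4) := by
  obtain ⟨s, hs, hr⟩ := runs_machOfFinTM2 h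
  let := tm.kFin
  let : Fintype (IOAlphabet A B (importAlphabet A B tm) (.inr (.inr tm.k₁))) :=
    Fintype.ofEquiv B e₁.symm
  refine ⟨(x.length + 1) + ((x.reverse.length + 1) + (s + (((haltList tm
    (y.map e₁.invFun)).stk tm.k₁).length + 1 + (y.reverse.length + 1)))), ?_, Mach.Runs.seq
    (S' := ioStk (Γ := importAlphabet A B tm) [] []
      (fun | .inl false => x.reverse | .inl true => [] | .inr _ => []))
    (Mach.runs_move (Γ := IOAlphabet A B (importAlphabet A B tm)) _ _ (by nofun) rfl ?_ ?_) <|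
    Mach.Runs.seq
    (S' := ioStk (Γ := importAlphabet A B tm) [] []
      (fun | .inl false => [] | .inl true => []
           | .inr k => (initList tm (x.map e₀.invFun)).stk k))
    (Mach.runs_move (Γ := IOAlphabet A B (importAlphabet A B tm)) _ _ (by nofun) rfl ?_ ?_) <|
    Mach.Runs.seq
    (S' := ioStk (Γ := importAlphabet A B tm) [] []
      (fun | .inl false => [] | .inl true => []
           | .inr k => (haltList tm (y.map e₁.invFun)).stk k))
    (hr.embed _ ?_ ?_ ?_) <|
    Mach.Runs.seq
    (S' := ioStk (Γ := importAlphabet A B tm) [] []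
      (fun | .inl false => [] | .inl true => y.reverse | .inr _ => []))
    (Mach.runs_move (Γ := IOAlphabet A B (importAlphabet A B tm)) _ _ (by nofun) rfl ?_ ?_)
    (Mach.runs_move (Γ := IOAlphabet A B (importAlphabet A B tm)) _ _ (by nofun) rfl ?_ ?_)⟩
  · rw [haltList_stk_self]
    simp only [List.length_reverse, List.length_map]
    lia
  · change x.reverse = (x.map fun a => a).reverse ++ []
    simp
  · rintro ((_ | _) | (_ | _) | _) h h'
    exacts [absurd rfl h, rfl, absurd rfl h', rfl, rfl]
  · change (initList tm (x.map e₀.invFun)).stk tm.k₀ =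
      (x.reverse.map fun a => e₀.symm a).reverse ++ []
    rw [initList_stk_self]
    simp
  · rintro ((_ | _) | (_ | _) | k) h h'
    · rfl
    · rfl
    · exact absurd rfl h
    · rfl
    · exact initList_stk_of_ne tm _ fun hk => h' (by rw [hk])
  · exact fun k => (List.map_id _).symm
  · exact fun k => (List.map_id _).symm
  · rintro ((_ | _) | (_ | _) | k) h
    exacts [rfl, rfl, rfl, rfl, absurd rfl (h k)]
  · change y.reverse = (((haltList tm (y.map e₁.invFun)).stk tm.k₁).map fun a => e₁ a).reverse ++ []
    rw [haltList_stk_self]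
    simp
  · rintro ((_ | _) | (_ | _) | k) h h'
    · rfl
    · rfl
    · rfl
    · exact absurd rfl h'
    · exact (haltList_stk_of_ne tm _ fun hk => h (by rw [hk])).symm
  · change y = (y.reverse.map fun a => a).reverse ++ []
    simp
  · rintro ((_ | _) | (_ | _) | k) h h'
    exacts [rfl, absurd rfl h', rfl, absurd rfl h, rfl]

/-- A machine as one of Mathlib's machines. -/
def FMach.toFinTM2 [Fintype A] (M : FMach A B) : FinTM2 where
  K := Bool ⊕ M.H
  k₀ := .inl false
  k₁ := .inl true
  Γ := IOAlphabet A B M.Γ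
  Λ := M.M.Λ
  main := M.M.start
  σ := M.M.σ
  initialState := M.M.init
  Γk₀Fin := inferInstanceAs (Fintype A)
  m := M.M.code

theorem FMach.Maps.nonempty_outputs [Fintype A] {M : FMach A B} {x : List A} {y : List B} {t : ℕ}
    (h : M.Maps x y t) : Nonempty (TM2OutputsInTime M.toFinTM2 x (some y) t) := by
  obtain ⟨s, hs, hr⟩ := h
  have h₀ : initList M.toFinTM2 x = ⟨some M.M.start, M.M.init, ioStk x [] fun _ => []⟩ := by
    have : (initList M.toFinTM2 x).stk = ioStk x [] fun _ => [] := by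
      funext k
      rcases k with (_ | _) | k
      exacts [initList_stk_self M.toFinTM2 x, initList_stk_of_ne M.toFinTM2 x nofun,
        initList_stk_of_ne M.toFinTM2 x nofun]
    rw [← this]
    rfl
  have h₁ : haltList M.toFinTM2 y = ⟨none, M.M.init, ioStk [] y fun _ => []⟩ := by
    have : (haltList M.toFinTM2 y).stk = ioStk [] y fun _ => [] := by
      funext k
      rcases k with (_ | _) | k
      exacts [haltList_stk_of_ne M.toFinTM2 y nofun, haltList_stk_self M.toFinTM2 y,
        haltList_stk_of_ne M.toFinTM2 y nofun]
    rw [← this]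
    rfl
  refine ⟨⟨⟨s, ?_⟩, hs⟩⟩
  rw [h₀]
  exact (steps_iff_iterate.1 hr).trans (congrArg some h₁.symm)

end MachineConstructions

section PolynomialTime

/-! ### Functions computable in polynomial time -/

variable {A B C α β γ δ : Type}

theorem eval_mono (p : ℕ[X]) : Monotone fun n => p.eval n := by
  intro m n h
  induction p using Polynomial.induction_on' with
  | add p q hp hq => simpa using Nat.add_le_add hp hq
  | monomial k a => simpa using Nat.mul_le_mul_left a (Nat.pow_le_pow_left h k)

/-- The function `f` is computable in polynomial time, with respect to the encodings `ea` and
`eb`. -/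
def Computes (ea : α → List A) (eb : β → List B) (f : α → β) : Prop :=
  ∃ (M : FMach A B) (p : ℕ[X]), ∀ a, M.Maps (ea a) (eb (f a)) (p.eval (ea a).length)

theorem Computes.exists_length_le {ea : α → List A} {eb : β → List B} {f : α → β}
    (h : Computes ea eb f) : ∃ p : ℕ[X], ∀ a, (eb (f a)).length ≤ p.eval (ea a).length := by
  obtain ⟨M, p, h⟩ := h
  obtain ⟨c, hc⟩ := M.exists_length_le
  exact ⟨X + p * C c, fun a => by simpa using hc _ _ _ (h a)⟩

theorem Computes.comp {ea : α → List A} {eb : β → List B} {ec : γ → List C} {g : β → γ}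
    {f : α → β} (hg : Computes eb ec g) (hf : Computes ea eb f) :
    Computes ea ec fun a => g (f a) := by
  obtain ⟨q, hq⟩ := hf.exists_length_le
  obtain ⟨M₁, p₁, h₁⟩ := hf
  obtain ⟨M₂, p₂, h₂⟩ := hg
  refine ⟨M₁.comp M₂, p₁ + p₂.comp q, fun a => ((h₁ a).comp (h₂ _)).mono ?_⟩
  simpa using eval_mono p₂ (hq a)

/-- Import of Mathlib's machines. Copying the output takes time proportional to its length, which is
bounded by a multiple of the running time. -/
theorem Computes.of_tm2 [Fintype A] [Fintype B] [Inhabited A] [Inhabited B] {ea : α → List A}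
    {eb : β → List B} {f : α → β} (h : Nonempty (TM2ComputableInPolyTime ea eb f)) :
    Computes ea eb f := by
  obtain ⟨⟨⟨tm, e₀, e₁⟩, p, h⟩⟩ := h
  have hlen : ∀ a, (eb (f a)).length ≤
      (ea a).length + p.eval (ea a).length * ∑ l, pushCount ((machOfFinTM2 tm).code l) := by
    intro a
    obtain ⟨t, ht, hr⟩ := runs_machOfFinTM2 (h a)
    have := hr.length_le (n := (ea a).length) ?_ tm.k₁
    · rw [haltList_stk_self, List.length_map] at this
      exact this.trans (Nat.add_le_add_left (Nat.mul_le_mul_right _ ht) _)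
    · intro k
      by_cases hk : k = tm.k₀
      · subst hk
        rw [initList_stk_self, List.length_map]
      · rw [initList_stk_of_ne tm _ hk]
        exact Nat.zero_le _
  refine ⟨FMach.ofFinTM2 tm e₀ e₁,
    2 * X + 2 * (X + p * C (∑ l, pushCount ((machOfFinTM2 tm).code l))) + p + 4,
    fun a => (FMach.maps_ofFinTM2 e₀ e₁ (h a)).mono ?_⟩
  have := hlen a
  simp only [eval_add, eval_mul, eval_X, eval_C, eval_ofNat]
  lia

theorem Computes.nonempty_tm2 [Fintype A] {ea : α → List A} {eb : β → List B} {f : α → β}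
    (h : Computes ea eb f) : Nonempty (TM2ComputableInPolyTime ea eb f) := by
  obtain ⟨M, p, h⟩ := h
  exact ⟨⟨⟨M.toFinTM2, Equiv.refl A, Equiv.refl B⟩, p, fun a => by
    have := (h a).nonempty_outputs.some
    have e₀ : List.map (Equiv.refl A).invFun (ea a) = ea a := List.map_id _
    have e₁ : List.map (Equiv.refl B).invFun (eb (f a)) = eb (f a) := List.map_id _
    exact (congrArg₂ (fun u v => TM2OutputsInTime M.toFinTM2 u (some v) _) e₀ e₁).mpr this⟩⟩

theorem Computes.transduce {Q : Type} [Fintype Q] [Fintype A] [Fintype B] [Inhabited B]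
    (ea : α → List A) (s₀ : Q) (n : ℕ) (δ : Q → A → Q) (em : Q → A → List B) (fin : Q → List B)
    (hem : ∀ s a, (em s a).length ≤ n) (hfin : ∀ s, (fin s).length ≤ n) :
    Computes ea (id : List B → List B) fun a => OneWay.transduce δ em fin s₀ (ea a) :=
  ⟨FMach.transducer s₀ default n δ em fin, (X + 1) * (C n + 1) + 1, fun a => by
    simpa using FMach.maps_transducer s₀ default n δ em fin hem hfin (ea a)⟩

/-- A type whose elements are encoded by bit strings. -/
class Enc (α : Type) where
  /-- the code of an element -/
  enc : α → BitStr

export Enc (enc)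

instance : Enc (List Bool) := ⟨id⟩
instance : Enc ℕ := ⟨fun n => List.replicate n true⟩
instance : Enc Bool := ⟨fun b => [b]⟩
instance : Enc (Option (List Bool)) := ⟨encodeValue⟩
instance [Enc α] [Enc β] : Enc (α × β) := ⟨fun a => dbl (enc a.1) ++ enc a.2⟩

/-- The length of the code of an element. -/
def size [Enc α] (a : α) : ℕ := (enc a).length

@[simp] theorem enc_bits (x : BitStr) : enc x = x := rfl
@[simp] theorem enc_nat (n : ℕ) : enc n = List.replicate n true := rfl
@[simp] theorem enc_bool (b : Bool) : enc b = [b] := rfl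
@[simp] theorem enc_pair [Enc α] [Enc β] (a : α) (b : β) : enc (a, b) = dbl (enc a) ++ enc b := rfl
@[simp] theorem enc_none : enc (none : Option BitStr) = [] := rfl
@[simp] theorem enc_some (x : BitStr) : enc (some x) = true :: x := rfl

@[simp] theorem length_dbl (x : BitStr) : (dbl x).length = 2 * x.length + 1 := by
  simp [dbl, List.length_flatMap, Nat.mul_comm]

@[simp] theorem size_bits (x : BitStr) : size x = x.length := rfl
@[simp] theorem size_nat (n : ℕ) : size n = n := by simp [size]
@[simp] theorem size_pair [Enc α] [Enc β] (a : α) (b : β) :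
    size (a, b) = 2 * size a + 1 + size b := by simp [size]

/-- Polynomial-time computable functions between types with an encoding. -/
def PT [Enc α] [Enc β] (f : α → β) : Prop := Computes (enc : α → BitStr) (enc : β → BitStr) f

variable [Enc α] [Enc β] [Enc γ] [Enc δ]

theorem PT.exists_size_le {f : α → β} (h : PT f) : ∃ p : ℕ[X], ∀ a, size (f a) ≤ p.eval (size a) :=
  Computes.exists_length_le h

theorem PT.comp {g : β → γ} {f : α → β} (hg : PT g) (hf : PT f) : PT fun a => g (f a) :=
  Computes.comp hg hf

/-- Polynomial-time computability depends only on the effect on the codes. -/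
theorem PT.of_enc {F : BitStr → BitStr} (hF : PT F) {f : α → β} (h : ∀ a, F (enc a) = enc (f a)) :
    PT f := by
  obtain ⟨M, p, hM⟩ := hF
  exact ⟨M, p, fun a => h a ▸ hM (enc a)⟩

theorem PT.transduce {Q : Type} [Fintype Q] (s₀ : Q) (n : ℕ) (δ : Q → Bool → Q)
    (em : Q → Bool → BitStr) (fin : Q → BitStr) (hem : ∀ s a, (em s a).length ≤ n)
    (hfin : ∀ s, (fin s).length ≤ n) {f : α → β}
    (h : ∀ a, OneWay.transduce δ em fin s₀ (enc a) = enc (f a)) : PT f :=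
  PT.of_enc (Computes.transduce (enc : BitStr → BitStr) s₀ n δ em fin hem hfin) h

theorem PT.flatMap (n : ℕ) (e : Bool → BitStr) (c : BitStr) (hn : ∀ b, (e b).length ≤ n)
    (hc : c.length ≤ n) {f : α → β} (h : ∀ a, (enc a).flatMap e ++ c = enc (f a)) : PT f :=
  PT.transduce () n (fun _ _ => ()) (fun _ => e) (fun _ => c) (fun _ => hn) (fun _ => hc)
    fun a => by rw [transduce_unit, h]

theorem PT.id : PT (fun a : α => a) :=
  PT.flatMap 1 (fun b => [b]) [] (fun _ => le_rfl) (Nat.zero_le _) fun a => by simp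

theorem PT.const (b : β) : PT (fun _ : α => b) :=
  PT.flatMap (enc b).length (fun _ => []) (enc b) (fun _ => Nat.zero_le _) le_rfl fun a => by simp

/-- An automaton that reads a pair `dbl u ++ v` and replaces each bit of `u` and of `v` by a given
string. In the state `some false` it reads a marker, in the state `some true` a bit of `u`, and in
the state `none` a bit of `v`. -/
theorem PT.flatMap_pair (n : ℕ) (e₁ e₂ : Bool → BitStr) (h₁ : ∀ b, (e₁ b).length ≤ n)
    (h₂ : ∀ b, (e₂ b).length ≤ n) {f : α × β → γ}
    (h : ∀ a b, (enc a).flatMap e₁ ++ (enc b).flatMap e₂ = enc (f (a, b))) : PT f := by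
  refine PT.transduce (some false) n
    (fun s b => match s with
      | none => none
      | some false => if b then some true else none
      | some true => some false)
    (fun s b => match s with
      | none => e₂ b
      | some false => []
      | some true => e₁ b) (fun _ => []) ?_ (fun _ => Nat.zero_le _) ?_
  · rintro (_ | _ | _) b
    exacts [h₂ b, Nat.zero_le _, h₁ b]
  · rintro ⟨a, b⟩
    have hv : ∀ v : BitStr, OneWay.transduce
        (fun s b => match s with
          | none => none
          | some false => if b then some true else none
          | some true => some false)
        (fun s b => match s with
          | none => e₂ b
          | some false => []
          | some true => e₁ b) (fun _ => []) none v = v.flatMap e₂ := by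
      intro v
      induction v with
      | nil => rfl
      | cons a v ih => simp only [OneWay.transduce, ih, List.flatMap_cons]
    rw [← h, enc_pair]
    generalize enc a = u
    induction u with
    | nil => simp [dbl, OneWay.transduce, hv]
    | cons a u ih =>
      have : dbl (a :: u) = true :: a :: dbl u := by simp [dbl]
      rw [this]
      simp only [List.cons_append, OneWay.transduce, ih, if_true, List.nil_append,
        List.flatMap_cons, List.append_assoc]

theorem PT.fst : PT (fun p : α × β => p.1) :=
  PT.flatMap_pair 1 (fun b => [b]) (fun _ => []) (fun _ => le_rfl) (fun _ => Nat.zero_le _)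
    fun a b => by simp

theorem PT.snd : PT (fun p : α × β => p.2) :=
  PT.flatMap_pair 1 (fun _ => []) (fun b => [b]) (fun _ => Nat.zero_le _) (fun _ => le_rfl)
    fun a b => by simp

theorem PT.pair {f : α → β} {g : α → γ} (hf : PT f) (hg : PT g) : PT fun a => (f a, g a) := by
  obtain ⟨q, hq⟩ := hf.exists_size_le
  obtain ⟨M₁, p₁, h₁⟩ := hf
  obtain ⟨M₂, p₂, h₂⟩ := hg
  refine ⟨M₁.pair M₂, 2 * X + 2 * q + p₁ + p₂ + 5, fun a => ((h₁ a).pair (h₂ a)).mono ?_⟩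
  have : (enc (f a)).length ≤ q.eval (enc a).length := hq a
  simp only [eval_add, eval_mul, eval_X, eval_ofNat]
  lia

/-- The concatenation of the codes of two elements. -/
theorem PT.append_enc {f : α → β} {g : α → γ} (hf : PT f) (hg : PT g) :
    PT fun a => enc (f a) ++ enc (g a) :=
  (PT.flatMap_pair (f := fun p : β × γ => enc p.1 ++ enc p.2) 1 (fun b => [b]) (fun b => [b])
    (fun _ => le_rfl) (fun _ => le_rfl) fun a b => by simp).comp (hf.pair hg)

theorem PT.append {f g : α → BitStr} (hf : PT f) (hg : PT g) : PT fun a => f a ++ g a :=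
  hf.append_enc hg

/-- Case distinction: the machine computes `c a :: enc a` and branches on the first bit. -/
theorem PT.cond {c : α → Bool} {f g : α → β} (hc : PT c) (hf : PT f) (hg : PT g) :
    PT fun a => bif c a then f a else g a := by
  obtain ⟨M, p, h⟩ := hc.append_enc (PT.id (α := α))
  obtain ⟨M₁, p₁, h₁⟩ := hf
  obtain ⟨M₂, p₂, h₂⟩ := hg
  refine ⟨M.comp (M₁.branch M₂), p + p₁ + p₂ + 2, fun a => ?_⟩
  simp only [eval_add, eval_ofNat]
  have := h a
  simp only [enc_bool, enc_bits, List.cons_append, List.nil_append] at this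
  cases hca : c a
  · rw [hca] at this
    exact (this.comp ((h₂ a).branch_false M₁)).mono (by lia)
  · rw [hca] at this
    exact (this.comp ((h₁ a).branch_true M₂)).mono (by lia)

/-- An automaton that treats the first bit of its input in a special way. -/
theorem PT.flatMap_head (n : ℕ) (e₁ e₂ : Bool → BitStr) (c₁ c₂ : BitStr)
    (h₁ : ∀ b, (e₁ b).length ≤ n) (h₂ : ∀ b, (e₂ b).length ≤ n) (h₁' : c₁.length ≤ n)
    (h₂' : c₂.length ≤ n) {f : α → β}
    (h : ∀ a, (match enc a with
      | [] => c₁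
      | b :: l => e₁ b ++ (l.flatMap e₂ ++ c₂)) = enc (f a)) : PT f := by
  refine PT.transduce true n (fun _ _ => false) (fun s b => bif s then e₁ b else e₂ b)
    (fun s => bif s then c₁ else c₂) ?_ ?_ fun a => ?_
  · rintro (_ | _) b
    exacts [h₂ b, h₁ b]
  · rintro (_ | _)
    exacts [h₂', h₁']
  · have hl : ∀ l, OneWay.transduce (fun _ _ => false) (fun s b => bif s then e₁ b else e₂ b)
        (fun s => bif s then c₁ else c₂) false l = l.flatMap e₂ ++ c₂ := by
      intro l
      induction l with
      | nil => rfl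
      | cons b l ih => simp [OneWay.transduce, ih]
    rw [← h]
    rcases enc a with _ | ⟨b, l⟩
    · rfl
    · simp [OneWay.transduce, hl]

theorem PT.tail {f : α → BitStr} (hf : PT f) : PT fun a => (f a).tail :=
  (PT.flatMap_head (f := fun x : BitStr => x.tail) 1 (fun _ => []) (fun b => [b]) [] []
    (fun _ => Nat.zero_le _) (fun _ => le_rfl) (Nat.zero_le _) (Nat.zero_le _)
    (by rintro (_ | _) <;> simp)).comp hf

theorem PT.take_one {f : α → BitStr} (hf : PT f) : PT fun a => (f a).take 1 :=
  (PT.flatMap_head (f := fun x : BitStr => x.take 1) 1 (fun b => [b]) (fun _ => []) [] []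
    (fun _ => le_rfl) (fun _ => Nat.zero_le _) (Nat.zero_le _) (Nat.zero_le _)
    (by rintro (_ | _) <;> simp)).comp hf

/-- Whether the code of `f a` is nonempty. -/
theorem PT.enc_ne_nil {f : α → β} (hf : PT f) : PT fun a => !(enc (f a)).isEmpty :=
  (PT.flatMap_head (f := fun b : β => !(enc b).isEmpty) 1 (fun _ => [true]) (fun _ => [])
    [false] [] (fun _ => le_rfl) (fun _ => Nat.zero_le _) le_rfl (Nat.zero_le _)
    (fun b => by rcases enc b with _ | _ <;> simp)).comp hf

theorem PT.head_eq_true {f : α → BitStr} (hf : PT f) : PT fun a => (f a).headD false :=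
  (PT.flatMap_head (f := fun x : BitStr => x.headD false) 1 (fun b => [b]) (fun _ => [])
    [false] [] (fun _ => le_rfl) (fun _ => Nat.zero_le _) le_rfl (Nat.zero_le _)
    (by rintro (_ | _) <;> simp)).comp hf

theorem PT.dbl : PT dbl :=
  PT.flatMap 2 (fun b => [true, b]) [false] (fun _ => le_rfl) (by simp) fun _ => rfl

theorem PT.length {f : α → BitStr} (hf : PT f) : PT fun a => (f a).length :=
  (PT.flatMap (f := fun x : BitStr => x.length) 1 (fun _ => [true]) [] (fun _ => le_rfl)
    (Nat.zero_le _) (fun x => by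
      rw [List.append_nil]; exact (List.map_eq_flatMap (f := fun _ => true)).symm.trans
        (List.map_const' ..))).comp hf

/-- Bounded iteration: if the states `s` of the iteration `s ↦ f (a, s)`, started in `g a`, stay of
polynomial size during `n a` rounds, then the last one is computable in polynomial time. The
machine loops on the codes of the triples `(k, a, s)`, where `k` counts the remaining rounds: the
first bit of such a code tells whether `k` is positive. -/
theorem PT.iterate {f : α × β → β} {n : α → ℕ} {g : α → β} (hf : PT f) (hn : PT n) (hg : PT g)
    (p : ℕ[X]) (hp : ∀ a, ∀ i ≤ n a, size ((fun s => f (a, s))^[i] (g a)) ≤ p.eval (size a)) :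
    PT fun a => (fun s => f (a, s))^[n a] (g a) := by
  obtain ⟨q, hq⟩ := hn.exists_size_le
  have hpred : PT fun k : ℕ => k - 1 :=
    PT.of_enc (PT.id (α := BitStr)).tail (f := fun k : ℕ => k - 1) fun k => by
      cases k <;> simp [List.replicate_succ]
  have hstep : PT fun t : ℕ × α × β => (t.1 - 1, t.2.1, f t.2) :=
    (hpred.comp PT.fst).pair ((PT.fst.comp PT.snd).pair (hf.comp PT.snd))
  obtain ⟨M, r, hM⟩ := hstep
  have hinit : PT fun a => (n a, a, g a) := hn.pair (PT.id.pair hg)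
  obtain ⟨M₀, r₀, hM₀⟩ := hinit
  have hlast : PT fun t : ℕ × α × β => t.2.2 := PT.snd.comp PT.snd
  obtain ⟨M₁, r₁, hM₁⟩ := hlast
  -- `b` bounds the sizes of all the triples that occur.
  let b : ℕ[X] := 2 * q + 2 * X + 2 + p
  refine ⟨M₀.comp (M.loop.comp M₁),
    r₀ + ((q + 1) * (r.comp b + 2 * b + 3) + r₁.comp b), fun a => ?_⟩
  let t : ℕ → ℕ × α × β := fun i => (n a - i, a, (fun s => f (a, s))^[i] (g a))
  have hna : n a ≤ q.eval (size a) := by simpa using hq a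
  have hb : ∀ i ≤ n a, (enc (t i)).length ≤ b.eval (size a) := by
    intro i hi
    have h₁ := hp a i hi
    have h₂ : (enc (t i)).length = size (t i) := rfl
    simp only [h₂, t, size_pair, size_nat, b, eval_add, eval_mul, eval_X, eval_ofNat]
    lia
  have hloop : M.loop.Maps (enc (t 0)) (enc (t (n a)))
      ((n a + 1) * (r.eval (b.eval (size a)) + 2 * b.eval (size a) + 3)) := by
    refine FMach.maps_loop (x := fun i => enc (t i)) (fun i hi => ?_) hb (fun i hi => ?_) ?_
    · have h₁ := (hM (t i)).mono (eval_mono r (hb i hi.le))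
      have h₂ : ((t i).1 - 1, (t i).2.1, f (t i).2) = t (i + 1) := by
        simp only [t, Function.iterate_succ_apply', Nat.sub_sub]
      change M.Maps _ (enc ((t i).1 - 1, (t i).2.1, f (t i).2)) _ at h₁
      rwa [h₂] at h₁
    · obtain ⟨j, hj⟩ : ∃ j, n a - i = j + 1 := ⟨n a - i - 1, by lia⟩
      simp [t, hj, OneWay.dbl, List.replicate_succ]
    · simp [t, OneWay.dbl]
  have h₁ := (hM₁ (t (n a))).mono (eval_mono r₁ (hb _ le_rfl))
  refine ((hM₀ a).comp (hloop.comp h₁)).mono ?_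
  have h₂ : (enc a).length = size a := rfl
  simp only [h₂, eval_add, eval_mul, eval_comp, eval_one, eval_ofNat]
  gcongr

end PolynomialTime

section Library

variable {α β γ : Type} [Enc α] [Enc β] [Enc γ]

/-! ### A library of polynomial-time functions -/

/-- Functions with the same codes of the values are computable by the same machines. -/
theorem PT.recode {f : α → β} (hf : PT f) {g : α → γ} (h : ∀ a, enc (f a) = enc (g a)) : PT g := by
  obtain ⟨M, p, hM⟩ := hf
  exact ⟨M, p, fun a => h a ▸ hM a⟩

theorem PT.code {f : α → β} (hf : PT f) : PT fun a => enc (f a) :=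
  hf.recode fun _ => rfl

theorem PT.not {c : α → Bool} (hc : PT c) : PT fun a => !c a :=
  (hc.cond (PT.const false) (PT.const true)).recode fun a => by cases c a <;> rfl

theorem PT.and {c d : α → Bool} (hc : PT c) (hd : PT d) : PT fun a => c a && d a :=
  (hc.cond hd (PT.const false)).recode fun a => by cases c a <;> rfl

theorem PT.beq {c d : α → Bool} (hc : PT c) (hd : PT d) : PT fun a => c a == d a :=
  (hc.cond hd hd.not).recode fun a => by cases c a <;> simp

theorem PT.add {m n : α → ℕ} (hm : PT m) (hn : PT n) : PT fun a => m a + n a :=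
  (hm.append_enc hn).recode fun a => by simp

theorem iterate_tail (x : BitStr) (i : ℕ) : (fun s : BitStr => s.tail)^[i] x = x.drop i := by
  induction i with
  | zero => rfl
  | succ i ih => rw [iterate_succ_apply', ih, List.tail_drop]

theorem PT.drop {n : α → ℕ} {f : α → BitStr} (hn : PT n) (hf : PT f) :
    PT fun a => (f a).drop (n a) := by
  obtain ⟨q, hq⟩ := hf.exists_size_le
  refine (PT.iterate (f := fun p : α × BitStr => p.2.tail) PT.snd.tail hn hf q
    fun a i _ => ?_).recode fun a => by rw [iterate_tail]
  rw [iterate_tail, size_bits, List.length_drop]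
  exact (Nat.sub_le _ _).trans (hq a)

theorem PT.sub {m n : α → ℕ} (hm : PT m) (hn : PT n) : PT fun a => m a - n a :=
  (hn.drop hm.code).recode fun a => by simp

theorem PT.take {n : α → ℕ} {f : α → BitStr} (hn : PT n) (hf : PT f) :
    PT fun a => (f a).take (n a) := by
  have hit : ∀ (x : BitStr) (i : ℕ),
      (fun s : BitStr × BitStr => (s.1 ++ s.2.take 1, s.2.tail))^[i] ([], x) =
        (x.take i, x.drop i) := by
    intro x i
    induction i with
    | zero => rfl
    | succ i ih =>
      rw [iterate_succ_apply', ih, List.tail_drop, List.take_add]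
  obtain ⟨q, hq⟩ := hf.exists_size_le
  refine (PT.fst.comp (PT.iterate
    (f := fun p : α × BitStr × BitStr => (p.2.1 ++ p.2.2.take 1, p.2.2.tail))
    (((PT.fst.comp PT.snd).append (PT.snd.comp PT.snd).take_one).pair (PT.snd.comp PT.snd).tail)
    hn ((PT.const []).pair hf) (3 * q + 1) fun a i _ => ?_)).recode fun a => by rw [hit]
  rw [hit, size_pair, size_bits, size_bits, List.length_drop, List.length_take]
  have : (f a).length ≤ q.eval (size a) := hq a
  simp only [eval_add, eval_mul, eval_ofNat, eval_one]
  lia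

theorem PT.mul {m n : α → ℕ} (hm : PT m) (hn : PT n) : PT fun a => m a * n a := by
  have hit : ∀ a i, (fun s : ℕ => s + n a)^[i] 0 = i * n a := by
    intro a i
    induction i with
    | zero => simp
    | succ i ih => rw [iterate_succ_apply', ih, Nat.succ_mul]
  obtain ⟨p, hp⟩ := hm.exists_size_le
  obtain ⟨q, hq⟩ := hn.exists_size_le
  refine (PT.iterate (f := fun t : α × ℕ => t.2 + n t.1) (PT.snd.add (hn.comp PT.fst)) hm
    (PT.const 0) (p * q) fun a i hi => ?_).recode fun a => congrArg enc (hit a (m a))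
  refine (congrArg size (hit a i)).trans_le ?_
  rw [size_nat, eval_mul]
  have h₁ := hp a
  have h₂ := hq a
  rw [size_nat] at h₁ h₂
  exact Nat.mul_le_mul (hi.trans h₁) h₂

theorem PT.eval (p : ℕ[X]) {n : α → ℕ} (hn : PT n) : PT fun a => p.eval (n a) := by
  induction p using Polynomial.induction_on with
  | C c => exact (PT.const c).recode fun a => by simp
  | add p q hp hq => exact (hp.add hq).recode fun a => by simp
  | monomial k c ih => exact (ih.mul hn).recode fun a => by simp [pow_succ, mul_assoc]

theorem PT.pow {n : α → ℕ} (hn : PT n) (k : ℕ) : PT fun a => n a ^ k :=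
  (hn.eval (X ^ k)).recode fun a => by simp

theorem PT.nat_le {m n : α → ℕ} (hm : PT m) (hn : PT n) : PT fun a => decide (m a ≤ n a) :=
  (hm.sub hn).enc_ne_nil.not.recode fun a => by
    simp [Nat.sub_eq_zero_iff_le]

/-- One step of the comparison of two bit strings: remove the first bits if they agree. -/
def compareStep (s : BitStr × BitStr) : BitStr × BitStr :=
  bif ((!s.1.isEmpty) && (!s.2.isEmpty)) && (s.1.headD false == s.2.headD false) then
    (s.1.tail, s.2.tail) else s

theorem length_iterate_compareStep (i : ℕ) (s : BitStr × BitStr) :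
    (compareStep^[i] s).1.length ≤ s.1.length ∧ (compareStep^[i] s).2.length ≤ s.2.length := by
  induction i with
  | zero => exact ⟨le_rfl, le_rfl⟩
  | succ i ih =>
    rw [iterate_succ_apply']
    generalize compareStep^[i] s = t at ih
    unfold compareStep
    cases ((!t.1.isEmpty) && (!t.2.isEmpty)) && (t.1.headD false == t.2.headD false)
    · exact ih
    · simp only [cond_true, List.length_tail]
      lia

/-- The comparison gets stuck at the first difference, so that both strings are used up exactly if
they are equal. -/
theorem iterate_compareStep (x y : BitStr) :
    compareStep^[x.length] (x, y) = ([], []) ↔ x = y := by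
  induction x generalizing y with
  | nil => simp [eq_comm]
  | cons a x ih =>
    have stuck : ∀ i, compareStep (a :: x, y) = (a :: x, y) →
        compareStep^[i] (a :: x, y) = (a :: x, y) := fun i h => iterate_fixed h i
    rcases y with _ | ⟨b, y⟩
    · rw [stuck _ (by simp [compareStep])]
      simp
    · by_cases hab : a = b
      · subst hab
        rw [List.length_cons, iterate_succ_apply]
        have : compareStep (a :: x, a :: y) = (x, y) := by simp [compareStep]
        rw [this, ih]
        simp
      · rw [stuck _ (by
          have : (a == b) = false := by simpa using hab
          simp [compareStep, this])]
        simp [hab]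

theorem PT.eq_bits {f g : α → BitStr} (hf : PT f) (hg : PT g) : PT fun a => decide (f a = g a) := by
  obtain ⟨p, hp⟩ := hf.exists_size_le
  obtain ⟨q, hq⟩ := hg.exists_size_le
  have h₁ : PT fun t : α × BitStr × BitStr => t.2.1 := PT.fst.comp PT.snd
  have h₂ : PT fun t : α × BitStr × BitStr => t.2.2 := PT.snd.comp PT.snd
  have h₃ : PT fun t : α × BitStr × BitStr => (!t.2.1.isEmpty) := h₁.enc_ne_nil
  have h₄ : PT fun t : α × BitStr × BitStr => (!t.2.2.isEmpty) := h₂.enc_ne_nil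
  have hs : PT fun t : α × BitStr × BitStr => compareStep t.2 :=
    ((h₃.and h₄).and (h₁.head_eq_true.beq h₂.head_eq_true)).cond (h₁.tail.pair h₂.tail) PT.snd
  have hi := PT.iterate hs hf.length (hf.pair hg) (2 * p + 1 + q) fun a i _ => by
    obtain ⟨l₁, l₂⟩ := length_iterate_compareStep i (f a, g a)
    have h₁ : (f a).length ≤ p.eval (size a) := hp a
    have h₂ : (g a).length ≤ q.eval (size a) := hq a
    change size (_, _) ≤ _
    simp only [size_pair, size_bits, eval_add, eval_mul, eval_ofNat, eval_one]
    change 2 * (compareStep^[i] (f a, g a)).1.length + 1 +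
      (compareStep^[i] (f a, g a)).2.length ≤ _
    lia
  have h₅ : PT fun a => (!(compareStep^[(f a).length] (f a, g a)).1.isEmpty) :=
    (PT.fst.comp hi).enc_ne_nil
  have h₆ : PT fun a => (!(compareStep^[(f a).length] (f a, g a)).2.isEmpty) :=
    (PT.snd.comp hi).enc_ne_nil
  refine (h₅.not.and h₆.not).recode fun a => ?_
  congr 1
  rw [Bool.eq_iff_iff, decide_eq_true_iff, ← iterate_compareStep, Prod.ext_iff]
  simp

theorem PT.some {f : α → BitStr} (hf : PT f) : PT fun a => some (f a) :=
  ((PT.const [true]).append hf).recode fun a => by simp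

theorem PT.isSome {f : α → Option BitStr} (hf : PT f) : PT fun a => (f a).isSome :=
  hf.enc_ne_nil.recode fun a => by cases f a <;> simp

theorem PT.getD_nil {f : α → Option BitStr} (hf : PT f) : PT fun a => (f a).getD [] :=
  hf.code.tail.recode fun a => by cases f a <;> simp

/-- Bounded search: the state of the iteration consists of the next candidate and the result found
so far. -/
theorem PT.findSome {g : α → ℕ → Option BitStr} {n : α → ℕ}
    (hg : PT fun p : α × ℕ => g p.1 p.2) (hn : PT n) :
    PT fun a => (List.range (n a)).findSome? (g a) := by
  have hit : ∀ a i, (fun s : ℕ × Option BitStr =>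
      (s.1 + 1, bif s.2.isSome then s.2 else g a s.1))^[i] (0, none) =
        (i, (List.range i).findSome? (g a)) := by
    intro a i
    induction i with
    | zero => rfl
    | succ i ih =>
      rw [iterate_succ_apply', ih, List.range_succ, List.findSome?_append]
      cases (List.range i).findSome? (g a) <;> simp [List.findSome?]
      cases g a i <;> rfl
  obtain ⟨p, hp⟩ := hg.exists_size_le
  obtain ⟨q, hq⟩ := hn.exists_size_le
  have h₁ : PT fun t : α × ℕ × Option BitStr => t.2.1 := PT.fst.comp PT.snd
  have h₂ : PT fun t : α × ℕ × Option BitStr => t.2.2 := PT.snd.comp PT.snd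
  have h₃ : PT fun t : α × ℕ × Option BitStr => g t.1 t.2.1 := hg.comp (PT.fst.pair h₁)
  refine (PT.snd.comp (PT.iterate ((h₁.add (PT.const 1)).pair (h₂.isSome.cond h₂ h₃)) hn
    ((PT.const 0).pair (PT.const none)) (2 * q + 1 + p.comp (2 * X + 1 + q))
    fun a i hi => ?_)).recode fun a => congrArg (fun s => enc s.2) (hit a (n a))
  have hna : n a ≤ q.eval (size a) := by simpa using hq a
  refine (congrArg size (hit a i)).trans_le ?_
  rw [size_pair, size_nat]
  have : size ((List.range i).findSome? (g a)) ≤ p.eval (2 * size a + 1 + q.eval (size a)) := by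
    rcases h : (List.range i).findSome? (g a) with _ | x
    · simp [size]
    · obtain ⟨j, hj, hx⟩ := List.exists_of_findSome?_eq_some h
      rw [← hx]
      refine (hp (a, j)).trans (eval_mono p ?_)
      rw [size_pair, size_nat]
      have := List.mem_range.1 hj
      lia
  simp only [eval_add, eval_mul, eval_comp, eval_X, eval_ofNat, eval_one]
  lia

/-! ### Arguments of probabilistic functions -/

/-- An automaton that turns the string `1ⁿ # y # r` into the code of `(n, y, r)`; its state is the
number of separators read so far. -/
theorem computes_psi_to_bits : Computes encodePsi (enc : Psi → BitStr) fun w => w := by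
  let em : Fin 3 → Option Bool → BitStr := fun s a => match a with
    | none => [false]
    | some b => if s = 2 then [b] else [true, b]
  let δ : Fin 3 → Option Bool → Fin 3 := fun s a => if a = none then s + 1 else s
  obtain ⟨M, p, hM⟩ := Computes.transduce encodePsi (0 : Fin 3) 2 δ em (fun _ => []) (by
    rintro s (_ | b)
    · exact Nat.le_succ 1
    · simp only [em]; split_ifs <;> simp) (fun _ => Nat.zero_le 2)
  refine ⟨M, p, fun w => ?_⟩
  have h₁ : ∀ (s : Fin 3), s ≠ 2 → ∀ (u : BitStr) (l : List (Option Bool)),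
      transduce δ em (fun _ => []) s (u.map some ++ none :: l) =
        dbl u ++ transduce δ em (fun _ => []) (s + 1) l := by
    intro s hs u l
    induction u with
    | nil => simp [transduce, em, δ, dbl]
    | cons a u ih =>
      have : dbl (a :: u) = true :: a :: dbl u := by simp [dbl]
      rw [this]
      simp only [List.map_cons, List.cons_append, transduce, em, δ, if_neg hs, reduceCtorEq,
        if_false, List.nil_append, List.cons.injEq, true_and]
      exact ih
  have h₂ : ∀ u : BitStr, transduce δ em (fun _ => []) 2 (u.map some) = u := by
    intro u
    induction u with
    | nil => rfl
    | cons a u ih =>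
      simp only [List.map_cons, transduce, em, δ, if_true, reduceCtorEq, if_false,
        List.cons_append, List.nil_append, List.cons.injEq, true_and]
      exact ih
  have h : transduce δ em (fun _ => []) 0 (encodePsi w) = enc w := by
    obtain ⟨n, y, r⟩ := w
    rw [encodePsi, h₁ 0 (by decide), h₁ (0 + 1) (by decide)]
    exact congrArg (fun z => dbl _ ++ (dbl y ++ z)) (h₂ r)
  have := hM w
  change M.Maps _ (transduce δ em (fun _ => []) 0 (encodePsi w)) _ at this
  rwa [h] at this

/-- An automaton that turns the code of `(n, y, r)` into the string `1ⁿ # y # r`; its state is the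
number of completed components, and whether the next bit belongs to an incomplete component (or is a
marker). -/
theorem computes_bits_to_psi : Computes (enc : Psi → BitStr) encodePsi fun w => w := by
  let em : Fin 3 × Bool → Bool → List (Option Bool) := fun s b =>
    if s.1 = 2 ∨ s.2 = true then [some b] else if b then [] else [none]
  let δ : Fin 3 × Bool → Bool → Fin 3 × Bool := fun s b =>
    if s.1 = 2 then s else if s.2 then (s.1, false) else if b then (s.1, true) else (s.1 + 1, false)
  obtain ⟨M, p, hM⟩ := Computes.transduce (enc : Psi → BitStr) ((0, false) : Fin 3 × Bool) 1 δ em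
    (fun _ => []) (by
      rintro s b
      simp only [em]
      split_ifs <;> simp) (fun _ => Nat.zero_le 1)
  refine ⟨M, p, fun w => ?_⟩
  have h₁ : ∀ (s : Fin 3), s ≠ 2 → ∀ (u l : BitStr),
      transduce δ em (fun _ => []) (s, false) (dbl u ++ l) =
        u.map some ++ none :: transduce δ em (fun _ => []) (s + 1, false) l := by
    intro s hs u l
    induction u with
    | nil => simp [transduce, em, δ, dbl, hs]
    | cons a u ih =>
      have : dbl (a :: u) = true :: a :: dbl u := by simp [dbl]
      rw [this]
      simp only [List.cons_append, transduce]
      have e₁ : em (s, false) true = [] := by simp [em, hs]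
      have e₂ : δ (s, false) true = (s, true) := by simp [δ, hs]
      have e₃ : em (s, true) a = [some a] := by simp [em]
      have e₄ : δ (s, true) a = (s, false) := by simp [δ, hs]
      rw [e₁, e₂, e₃, e₄, ih]
      rfl
  have h₂ : ∀ u : BitStr, transduce δ em (fun _ => []) (2, false) u = u.map some := by
    intro u
    induction u with
    | nil => rfl
    | cons a u ih =>
      have e₁ : em (2, false) a = [some a] := by simp [em]
      have e₂ : δ (2, false) a = (2, false) := by simp [δ]
      rw [transduce, e₁, e₂, ih]
      rfl
  have h : transduce δ em (fun _ => []) (0, false) (enc w) = encodePsi w := by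
    obtain ⟨n, y, r⟩ := w
    change transduce δ em (fun _ => []) (0, false) (dbl (List.replicate n true) ++ (dbl y ++ r)) = _
    rw [h₁ 0 (by decide), h₁ (0 + 1) (by decide)]
    exact congrArg (fun z => _ ++ none :: (_ ++ none :: z)) (h₂ r)
  have := hM w
  change M.Maps _ (transduce δ em (fun _ => []) (0, false) (enc w)) _ at this
  rwa [h] at this

theorem PPT.pt (G : PPT) : PT G.toFun :=
  (Computes.of_tm2 G.polyTime).comp computes_bits_to_psi

/-- The probabilistic function given by a function computable in polynomial time. -/
def PPT.ofPT (q : ℕ[X]) (f : Psi → Option BitStr) (hf : PT f) : PPT where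
  coins := q
  toFun := f
  polyTime := (Computes.comp hf computes_psi_to_bits).nonempty_tm2

theorem polyTime_iff_pt {F : BitStr → BitStr} : PolyTime F ↔ PT F :=
  ⟨fun h => Computes.of_tm2 h, fun h => h.nonempty_tm2⟩

end Library

section Averages

/-! ### Averages over random bit strings -/

/-- The expectation of `f X` for `X` uniformly distributed on the bit strings of length `n`. -/
noncomputable def avg : ℕ → (BitStr → ℝ) → ℝ
  | 0, f => f []
  | n + 1, f => (avg n (fun x => f (false :: x)) + avg n (fun x => f (true :: x))) / 2

theorem avg_mono {n : ℕ} {f g : BitStr → ℝ} (h : ∀ x, x.length = n → f x ≤ g x) :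
    avg n f ≤ avg n g := by
  induction n generalizing f g with
  | zero => exact h [] rfl
  | succ n ih =>
    have h₁ := ih (f := fun x => f (false :: x)) fun x hx => h (false :: x) (by simp [hx])
    have h₂ := ih (f := fun x => f (true :: x)) fun x hx => h (true :: x) (by simp [hx])
    simp only [avg]
    linarith

theorem avg_congr {n : ℕ} {f g : BitStr → ℝ} (h : ∀ x, x.length = n → f x = g x) :
    avg n f = avg n g :=
  le_antisymm (avg_mono fun x hx => (h x hx).le) (avg_mono fun x hx => (h x hx).ge)

@[simp] theorem avg_const (n : ℕ) (c : ℝ) : avg n (fun _ => c) = c := by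
  induction n with
  | zero => rfl
  | succ n ih => simp [avg, ih]

theorem avg_add (n : ℕ) (f g : BitStr → ℝ) : avg n (fun x => f x + g x) = avg n f + avg n g := by
  induction n generalizing f g with
  | zero => rfl
  | succ n ih => simp only [avg, ih]; ring

theorem avg_mul_left (n : ℕ) (c : ℝ) (f : BitStr → ℝ) : avg n (fun x => c * f x) = c * avg n f := by
  induction n generalizing f with
  | zero => rfl
  | succ n ih => simp only [avg, ih]; ring

theorem avg_one_sub (n : ℕ) (f : BitStr → ℝ) : avg n (fun x => 1 - f x) = 1 - avg n f := by
  have h := avg_add n (fun _ => 1) (fun x => -1 * f x)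
  rw [avg_mul_left, avg_const] at h
  rw [sub_eq_add_neg, ← neg_one_mul, ← h]
  exact avg_congr fun x _ => by ring

theorem avg_sum {ι : Type*} (s : Finset ι) (n : ℕ) (f : ι → BitStr → ℝ) :
    avg n (fun x => ∑ i ∈ s, f i x) = ∑ i ∈ s, avg n (f i) := by
  induction s using Finset.cons_induction with
  | empty => simp
  | cons a s ha ih => simp only [Finset.sum_cons, avg_add, ih]

theorem avg_append (m n : ℕ) (f : BitStr → ℝ) :
    avg (m + n) f = avg m fun x => avg n fun y => f (x ++ y) := by
  induction m generalizing f with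
  | zero => simp [avg]
  | succ m ih => rw [Nat.succ_add]; simp only [avg, ih, List.cons_append]

/-- Fubini's theorem. -/
theorem avg_comm (m n : ℕ) (f : BitStr → BitStr → ℝ) :
    avg m (fun x => avg n fun y => f x y) = avg n fun y => avg m fun x => f x y := by
  induction m generalizing f with
  | zero => rfl
  | succ m ih =>
    simp only [avg, ih, div_eq_inv_mul]
    rw [avg_mul_left, avg_add]

/-- The average over the strings of length `N` may be computed by averaging over longer strings and
ignoring the last bits. -/
theorem avg_take {N B : ℕ} (h : N ≤ B) (f : BitStr → ℝ) :
    avg B (fun x => f (x.take N)) = avg N f := by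
  obtain ⟨m, rfl⟩ := Nat.exists_eq_add_of_le h
  rw [avg_append]
  refine avg_congr fun x hx => ?_
  rw [← avg_const m (f x)]
  exact avg_congr fun y _ => by rw [List.take_left' hx]

theorem avg_eq_sum (n : ℕ) (f : BitStr → ℝ) :
    avg n f = (∑ x : Fin n → Bool, f (List.ofFn x)) / 2 ^ n := by
  induction n generalizing f with
  | zero => simp [avg]
  | succ n ih =>
    rw [avg, ih, ih, ← (Fin.consEquiv fun _ : Fin (n + 1) => Bool).sum_comp, Fintype.sum_prod_type,
      Fintype.sum_bool]
    simp only [Fin.consEquiv, Equiv.coe_fn_mk, List.ofFn_cons]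
    rw [pow_succ]
    field_simp
    ring

/-- The indicator of a proposition, as a real number. -/
noncomputable def ind (p : Prop) : ℝ := open Classical in if p then 1 else 0

theorem ind_true {p : Prop} (h : p) : ind p = 1 := if_pos h

theorem ind_false {p : Prop} (h : ¬p) : ind p = 0 := if_neg h

theorem ind_nonneg (p : Prop) : 0 ≤ ind p := by
  unfold ind; split_ifs <;> norm_num

theorem ind_le_one (p : Prop) : ind p ≤ 1 := by
  unfold ind; split_ifs <;> norm_num

theorem ind_mono {p q : Prop} (h : p → q) : ind p ≤ ind q := by
  by_cases hp : p
  · rw [ind_true hp, ind_true (h hp)]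
  · rw [ind_false hp]; exact ind_nonneg q

theorem avg_nonneg {n : ℕ} {f : BitStr → ℝ} (h : ∀ x, x.length = n → 0 ≤ f x) : 0 ≤ avg n f := by
  rw [← avg_const n 0]; exact avg_mono h

theorem avg_le_one {n : ℕ} {f : BitStr → ℝ} (h : ∀ x, x.length = n → f x ≤ 1) : avg n f ≤ 1 := by
  rw [← avg_const n 1]; exact avg_mono h

/-- The event that `G` inverts `F` at the string `x`, with coins `r`. -/
def Inverts (F : BitStr → BitStr) (G : PPT) (x r : BitStr) : Prop :=
  (G.toFun (x.length, F x, r)).map (aux F) = some (x.length, F x)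

theorem invertProb_eq_avg (F : BitStr → BitStr) (G : PPT) (n : ℕ) :
    invertProb F G n = avg n fun x => avg (G.coins.eval n) fun r => ind (Inverts F G x r) := by
  classical
  simp only [avg_eq_sum]
  rw [← Finset.sum_div, ← Fintype.sum_prod_type' (f := fun (x : Fin n → Bool)
    (r : Fin (G.coins.eval n) → Bool) => ind (Inverts F G (List.ofFn x) (List.ofFn r)))]
  rw [invertProb, challenge, PMF.toOuterMeasure_map_apply,
    PMF.toOuterMeasure_uniformOfFintype_apply, ENNReal.toReal_div]
  simp only [ENNReal.toReal_natCast, Fintype.card_prod, Fintype.card_fun, Fintype.card_fin,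
    Fintype.card_bool, Nat.cast_mul, Nat.cast_pow, Nat.cast_ofNat, ind, Finset.sum_boole]
  rw [div_div, mul_comm]
  congr 2
  rw [Fintype.card_subtype]
  congr 1
  ext p
  simp [Inverts, dropCoins]

/-! ### Strings consisting of blocks -/

/-- The `i`-th block of length `n` of the string `x`. -/
def block (n i : ℕ) (x : BitStr) : BitStr := (x.drop (i * n)).take n

theorem block_zero_append {n : ℕ} {x : BitStr} (hx : x.length = n) (y : BitStr) :
    block n 0 (x ++ y) = x := by
  simp [block, List.take_left' hx]

theorem block_succ_append {n : ℕ} {x : BitStr} (hx : x.length = n) (i : ℕ) (y : BitStr) :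
    block n (i + 1) (x ++ y) = block n i y := by
  subst hx
  rw [block, block, Nat.succ_mul, Nat.add_comm, List.drop_length_add_append]

/-- The blocks of a random string are independent. -/
theorem avg_prod_block (n k m : ℕ) (h : BitStr → ℝ) :
    avg (k * n + m) (fun x => ∏ i ∈ Finset.range k, h (block n i x)) = avg n h ^ k := by
  induction k with
  | zero => simp
  | succ k ih =>
    have e : (k + 1) * n + m = n + (k * n + m) := by ring
    rw [e, avg_append, pow_succ', ← ih, mul_comm (avg n h), ← avg_mul_left n]
    refine avg_congr fun x hx => ?_
    rw [mul_comm _ (h x), ← avg_mul_left]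
    refine avg_congr fun y _ => ?_
    rw [Finset.prod_range_succ', block_zero_append hx, mul_comm]
    simp only [block_succ_append hx]

/-- The string `u` with its `i`-th block of length `n` replaced by `x`. -/
def setBlock (n i : ℕ) (x u : BitStr) : BitStr := u.take (i * n) ++ x ++ u.drop ((i + 1) * n)

theorem length_setBlock {n i : ℕ} {x u : BitStr} (hx : x.length = n)
    (hu : (i + 1) * n ≤ u.length) : (setBlock n i x u).length = u.length := by
  have : (i + 1) * n = i * n + n := by ring
  simp only [setBlock, List.length_append, List.length_take, List.length_drop]
  lia

/-- A random string is obtained by replacing the `i`-th block of a random string by a random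
block. -/
theorem avg_block_mul {n k i m : ℕ} (hi : i < k) (g f : BitStr → ℝ) :
    avg (k * n + m) (fun x => g (block n i x) * f x) =
      avg n fun x => g x * avg (k * n + m) fun u => f (setBlock n i x u) := by
  obtain ⟨j, rfl⟩ := Nat.exists_eq_add_of_lt hi
  have e : (i + j + 1) * n + m = i * n + (n + (j * n + m)) := by ring
  have hblock : ∀ u v w : BitStr, u.length = i * n → v.length = n →
      block n i (u ++ (v ++ w)) = v := by
    intro u v w hu hv
    rw [block, ← hu, List.drop_left, List.take_left' hv]
  have hset : ∀ x u v w : BitStr, u.length = i * n → v.length = n →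
      setBlock n i x (u ++ (v ++ w)) = u ++ (x ++ w) := by
    intro x u v w hu hv
    have : (i + 1) * n = (u ++ v).length := by rw [List.length_append, hu, hv]; ring
    rw [setBlock, this, ← List.append_assoc u v w, List.drop_left, List.append_assoc u v w,
      List.take_left' hu, List.append_assoc]
  simp only [e, avg_append (i * n) (n + (j * n + m)), avg_append n (j * n + m)]
  calc avg (i * n) (fun u => avg n fun v => avg (j * n + m) fun w =>
        g (block n i (u ++ (v ++ w))) * f (u ++ (v ++ w)))
      = avg (i * n) fun u => avg n fun v => avg (j * n + m) fun w => g v * f (u ++ (v ++ w)) :=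
        avg_congr fun u hu => avg_congr fun v hv => avg_congr fun w _ => by rw [hblock u v w hu hv]
    _ = avg n fun v => avg (i * n) fun u => avg (j * n + m) fun w => g v * f (u ++ (v ++ w)) :=
        avg_comm _ _ _
    _ = _ := avg_congr fun x _ => by
      rw [← avg_mul_left]
      refine avg_congr fun u hu => ?_
      rw [avg_mul_left]
      congr 1
      rw [← avg_const n (avg (j * n + m) fun w => f (u ++ (x ++ w)))]
      exact avg_congr fun v hv => avg_congr fun w _ => by rw [hset x u v w hu hv]

/-- A test `s` that succeeds with random blocks succeeds with probability at most
`(1 - β) ^ k + k * ε`, if a random block is bad with probability `β`, and the test succeeds with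
probability at most `ε` whenever one of the blocks is a fixed bad one and the other blocks are
random. -/
theorem avg_le_of_bad (n k m : ℕ) (s : BitStr → ℝ) (h₀ : ∀ x, 0 ≤ s x) (h₁ : ∀ x, s x ≤ 1)
    (Bad : BitStr → Prop) (ε : ℝ)
    (hB : ∀ x, x.length = n → Bad x → ∀ i < k,
      avg (k * n + m) (fun u => s (setBlock n i x u)) ≤ ε) (hε : 0 ≤ ε) :
    avg (k * n + m) s ≤ (1 - avg n fun x => ind (Bad x)) ^ k + k * ε := by
  rw [← avg_one_sub, ← avg_prod_block n k m]
  have hsum : ∑ i ∈ Finset.range k,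
      avg (k * n + m) (fun x => ind (Bad (block n i x)) * s x) ≤ k * ε := by
    rw [← nsmul_eq_mul, ← Finset.card_range k, Finset.card_range k]
    refine (Finset.sum_le_card_nsmul _ _ ε fun i hi => ?_).trans_eq (by rw [Finset.card_range])
    rw [avg_block_mul (Finset.mem_range.1 hi) (fun x => ind (Bad x)) s, ← avg_const n ε]
    refine avg_mono fun x hx => ?_
    by_cases hb : Bad x
    · rw [ind_true hb, one_mul]; exact hB x hx hb i (Finset.mem_range.1 hi)
    · rw [ind_false hb, zero_mul]; exact hε
  rw [← avg_sum] at hsum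
  refine le_trans ?_ (add_le_add_right hsum _)
  rw [← avg_add]
  refine avg_mono fun x _ => ?_
  have hnn : ∀ i ∈ Finset.range k, 0 ≤ ind (Bad (block n i x)) * s x := fun i _ =>
    mul_nonneg (ind_nonneg _) (h₀ x)
  by_cases hb : ∃ i ∈ Finset.range k, Bad (block n i x)
  · obtain ⟨i, hi, hb⟩ := hb
    have h₂ := Finset.single_le_sum hnn hi
    rw [ind_true hb, one_mul] at h₂
    have h₃ : 0 ≤ ∏ i ∈ Finset.range k, (1 - ind (Bad (block n i x))) :=
      Finset.prod_nonneg fun i _ => sub_nonneg.2 (ind_le_one _)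
    linarith
  · push Not at hb
    have h₂ : ∏ i ∈ Finset.range k, (1 - ind (Bad (block n i x))) = 1 :=
      Finset.prod_eq_one fun i hi => by rw [ind_false (hb i hi), sub_zero]
    have h₃ := Finset.sum_nonneg hnn
    linarith [h₁ x]

end Averages

section Amplification

/-! ### The direct product of a function -/

/-- Replace the first `k` blocks of length `n` of a string by their images under `Φ`. -/
def mapBlocks (Φ : BitStr → BitStr) (n : ℕ) : ℕ → BitStr → BitStr
  | 0, x => x
  | k + 1, x => Φ (x.take n) ++ mapBlocks Φ n k (x.drop n)

theorem mapBlocks_add_append (Φ : BitStr → BitStr) (n i j : ℕ) (u v : BitStr)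
    (hu : u.length = i * n) :
    mapBlocks Φ n (i + j) (u ++ v) = mapBlocks Φ n i u ++ mapBlocks Φ n j v := by
  induction i generalizing u with
  | zero =>
    obtain rfl : u = [] := List.length_eq_zero_iff.1 (by simpa using hu)
    simp [mapBlocks]
  | succ i ih =>
    have hn : n ≤ u.length := by rw [hu, Nat.succ_mul]; exact Nat.le_add_left _ _
    rw [Nat.succ_add, mapBlocks, mapBlocks, List.take_append_of_le_length hn,
      List.drop_append_of_le_length hn, ih _ (by rw [List.length_drop, hu, Nat.succ_mul]; lia),
      List.append_assoc]

theorem mapBlocks_setBlock (Φ : BitStr → BitStr) {n i k : ℕ} (hi : i < k) {x u : BitStr}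
    (hx : x.length = n) (hu : k * n ≤ u.length) :
    mapBlocks Φ n k (setBlock n i x u) = mapBlocks Φ n i (u.take (i * n)) ++ Φ x ++
      mapBlocks Φ n (k - 1 - i) (u.drop ((i + 1) * n)) := by
  have hk : k = i + (1 + (k - 1 - i)) := by lia
  have hle : i * n ≤ u.length := (Nat.mul_le_mul_right n hi.le).trans hu
  rw [setBlock, List.append_assoc]
  conv_lhs => rw [hk]
  rw [mapBlocks_add_append _ _ _ _ _ _ (by rw [List.length_take, Nat.min_eq_left hle]),
    mapBlocks_add_append _ _ _ _ _ _ (by rw [hx, Nat.one_mul]), List.append_assoc]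
  simp [mapBlocks, List.take_of_length_le hx.le, List.drop_eq_nil_of_le hx.le]

/-- The images under `Φ` of strings of equal length can be read off from the beginning of a longer
string. -/
def Decodable (Φ : BitStr → BitStr) : Prop :=
  ∀ x x' u u' : BitStr, x.length = x'.length → Φ x ++ u = Φ x' ++ u' → Φ x = Φ x' ∧ u = u'

theorem Decodable.mapBlocks_eq {Φ : BitStr → BitStr} (hΦ : Decodable Φ) {n k : ℕ} {z x : BitStr}
    (hlen : z.length = x.length) (hx : k * n ≤ x.length)
    (h : mapBlocks Φ n k z = mapBlocks Φ n k x) :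
    (∀ i < k, Φ (block n i z) = Φ (block n i x)) ∧ z.drop (k * n) = x.drop (k * n) := by
  induction k generalizing z x with
  | zero => exact ⟨fun i hi => absurd hi (Nat.not_lt_zero i), by simpa [mapBlocks] using h⟩
  | succ k ih =>
    rw [Nat.succ_mul] at hx
    obtain ⟨h₁, h₂⟩ := hΦ _ _ _ _ (by simp only [List.length_take, hlen]) h
    obtain ⟨h₃, h₄⟩ := ih (by simp only [List.length_drop, hlen])
      (by rw [List.length_drop]; lia) h₂
    refine ⟨fun i hi => ?_, ?_⟩
    · rcases i with _ | i
      · simpa [block] using h₁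
      · simpa [block, List.drop_drop, Nat.succ_mul, Nat.add_comm] using h₃ i (by lia)
    · simpa [List.drop_drop, Nat.succ_mul, Nat.add_comm] using h₄

/-- One round of the search for a root: proceed to `m + 1` if `(m + 1) ^ d ≤ N`. -/
def rootStep (d N m : ℕ) : ℕ := bif decide ((m + 1) ^ d ≤ N) then m + 1 else m

/-- The largest `n` with `n ^ d ≤ N`, for `d ≠ 0`. -/
def root (d N : ℕ) : ℕ := (rootStep d N)^[N] 0

theorem iterate_rootStep_le (d N i : ℕ) : (rootStep d N)^[i] 0 ≤ i := by
  induction i with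
  | zero => rfl
  | succ i ih =>
    rw [iterate_succ_apply', rootStep]
    cases decide (((rootStep d N)^[i] 0 + 1) ^ d ≤ N) <;> simp only [cond_true, cond_false] <;> lia

theorem root_spec {d : ℕ} (hd : d ≠ 0) (N : ℕ) : root d N ^ d ≤ N ∧ N < (root d N + 1) ^ d := by
  have key : ∀ i, (rootStep d N)^[i] 0 ^ d ≤ N ∧
      ((rootStep d N)^[i] 0 = i ∨ N < ((rootStep d N)^[i] 0 + 1) ^ d) := by
    intro i
    induction i with
    | zero => simp [hd]
    | succ i ih =>
      rw [iterate_succ_apply']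
      generalize (rootStep d N)^[i] 0 = m at ih
      obtain ⟨h₁, h₂⟩ := ih
      unfold rootStep
      by_cases h : (m + 1) ^ d ≤ N
      · simp only [h, decide_true, cond_true, true_and]
        rcases h₂ with rfl | h₂
        · exact .inl rfl
        · exact absurd h (not_le.2 h₂)
      · simp only [h, decide_false, cond_false, h₁, true_and]
        exact .inr (not_le.1 h)
  obtain ⟨h₁, h₂⟩ := key N
  refine ⟨h₁, h₂.elim (fun h => ?_) id⟩
  rw [root, h]
  exact (Nat.lt_succ_self N).trans_le (Nat.le_self_pow hd _)

/-- The function that applies `Φ` to as many as `n ^ (a + 1)` blocks of length `n`, where `n` is as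
large as the length of the argument permits. -/
def amplify (a : ℕ) (Φ : BitStr → BitStr) (x : BitStr) : BitStr :=
  mapBlocks Φ (root (a + 2) x.length) (root (a + 2) x.length ^ (a + 1)) x

variable {α : Type} [Enc α]

theorem PT.nat_eq {m n : α → ℕ} (hm : PT m) (hn : PT n) : PT fun a => decide (m a = n a) :=
  ((hm.nat_le hn).and (hn.nat_le hm)).recode fun a => by
    rw [← Bool.decide_and, decide_eq_decide.2 Nat.le_antisymm_iff.symm]

theorem PT.block {n i : α → ℕ} {x : α → BitStr} (hn : PT n) (hi : PT i) (hx : PT x) :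
    PT fun a => OneWay.block (n a) (i a) (x a) :=
  hn.take ((hi.mul hn).drop hx)

theorem PT.root (d : ℕ) {n : α → ℕ} (hn : PT n) : PT fun a => root d (n a) := by
  have h : PT fun p : α × ℕ => rootStep d (n p.1) p.2 :=
    (((PT.snd.add (PT.const 1)).pow d).nat_le (hn.comp PT.fst)).cond
      (PT.snd.add (PT.const 1)) PT.snd
  obtain ⟨p, hp⟩ := hn.exists_size_le
  refine PT.iterate h hn (PT.const 0) p fun a i hi => ?_
  rw [size_nat]
  exact ((iterate_rootStep_le d (n a) i).trans hi).trans (by simpa using hp a)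

theorem PT.mapBlocks {Φ : BitStr → BitStr} (hΦ : PT Φ) {n k : α → ℕ} {x : α → BitStr} (hn : PT n)
    (hk : PT k) (hx : PT x) : PT fun a => mapBlocks Φ (n a) (k a) (x a) := by
  let f : ℕ → BitStr × BitStr → BitStr × BitStr := fun n s =>
    (s.1 ++ Φ (s.2.take n), s.2.drop n)
  have hit : ∀ n k s, ((f n)^[k] s).1 ++ ((f n)^[k] s).2 = s.1 ++ OneWay.mapBlocks Φ n k s.2 := by
    intro n k
    induction k with
    | zero => exact fun s => rfl
    | succ k ih =>
      intro s
      rw [iterate_succ_apply, ih]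
      simp [f, OneWay.mapBlocks]
  have hf : PT fun p : α × BitStr × BitStr => f (n p.1) p.2 :=
    ((PT.fst.comp PT.snd).append (hΦ.comp ((hn.comp PT.fst).take (PT.snd.comp PT.snd)))).pair
      ((hn.comp PT.fst).drop (PT.snd.comp PT.snd))
  obtain ⟨p, hp⟩ := hΦ.exists_size_le
  obtain ⟨q, hq⟩ := hx.exists_size_le
  obtain ⟨r, hr⟩ := hk.exists_size_le
  have hsize : ∀ n x i, ((f n)^[i] ([], x)).1.length ≤ i * p.eval x.length ∧
      ((f n)^[i] ([], x)).2.length ≤ x.length := by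
    intro n x i
    induction i with
    | zero => simp
    | succ i ih =>
      rw [iterate_succ_apply']
      obtain ⟨h₁, h₂⟩ := ih
      have h₃ := (hp (((f n)^[i] ([], x)).2.take n)).trans (eval_mono p
        (show (((f n)^[i] ([], x)).2.take n).length ≤ x.length from
          (List.length_take_le' _ _).trans h₂))
      rw [size_bits] at h₃
      simp only [f, List.length_append, List.length_drop]
      exact ⟨by rw [Nat.succ_mul]; exact Nat.add_le_add h₁ h₃, (Nat.sub_le _ _).trans h₂⟩
  have := PT.iterate hf hk ((PT.const []).pair hx) (2 * (r * p.comp q) + 1 + q) fun a i hi => by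
    obtain ⟨h₁, h₂⟩ := hsize (n a) (x a) i
    have h₃ : k a ≤ r.eval (size a) := by simpa using hr a
    have h₄ : (x a).length ≤ q.eval (size a) := hq a
    have h₅ := Nat.mul_le_mul (hi.trans h₃) (eval_mono p h₄)
    refine (size_pair ((f (n a))^[i] ([], x a)).1 ((f (n a))^[i] ([], x a)).2).trans_le ?_
    simp only [size_bits, eval_add, eval_mul, eval_comp, eval_ofNat, eval_one]
    simp only at h₅
    lia
  exact ((PT.fst.comp this).append (PT.snd.comp this)).recode fun a => by
    simpa using hit (n a) (k a) ([], x a)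

theorem PT.amplify (a : ℕ) {Φ : BitStr → BitStr} (hΦ : PT Φ) : PT (amplify a Φ) :=
  have h : PT fun x : BitStr => OneWay.root (a + 2) x.length := (PT.id.length).root (a + 2)
  hΦ.mapBlocks h (h.pow (a + 1)) PT.id

/-! ### The reduction -/

/-- The candidate for a solution that one trial of the reduction finds with the random bits `s`. The
challenge `y` is planted, in the code `E`, as the `i`-th block of a random value of the amplified
function at arguments of length `N`; the algorithm `G` is applied to it; and the `i`-th block of the
answer is returned. -/
def candidate (F E : BitStr → BitStr) (a : ℕ) (G : PPT) (n : ℕ) (y s : BitStr) (N i : ℕ) : BitStr :=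
  block n i ((G.toFun (N,
    mapBlocks (fun x => E (F x)) n i ((s.take N).take (i * n)) ++ E y ++
      mapBlocks (fun x => E (F x)) n (n ^ (a + 1) - 1 - i) ((s.take N).drop ((i + 1) * n)),
    (s.drop N).take (G.coins.eval N))).getD [])

/-- One trial of the reduction: the candidate is returned if it solves the challenge. -/
def trial (F E : BitStr → BitStr) (a : ℕ) (G : PPT) (n : ℕ) (y s : BitStr) (N i : ℕ) :
    Option BitStr :=
  bif decide ((candidate F E a G n y s N i).length = n) &&
    decide (F (candidate F E a G n y s N i) = y) then some (candidate F E a G n y s N i) else none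

theorem trial_sound {F E : BitStr → BitStr} {a : ℕ} {G : PPT} {n : ℕ} {y s v : BitStr} {N i : ℕ}
    (h : trial F E a G n y s N i = some v) : v.length = n ∧ F v = y := by
  unfold trial at h
  generalize candidate F E a G n y s N i = w at h
  by_cases hw : w.length = n ∧ F w = y
  · simp only [hw, decide_true, Bool.and_self, cond_true, Option.some.injEq] at h
    rwa [← h]
  · rw [← Bool.decide_and, decide_eq_false hw] at h
    simp at h

/-- If `G` inverts the amplified function at the string with `x` planted, the trial succeeds, since
the images of the blocks can be decoded. -/
theorem trial_isSome {F E : BitStr → BitStr} (hE : Injective E)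
    (hΦ : Decodable fun x => E (F x)) {a : ℕ} {G : PPT} {n N i : ℕ} (hN : root (a + 2) N = n)
    (hi : i < n ^ (a + 1)) {x s : BitStr} (hx : x.length = n) (hs : N ≤ s.length)
    (h : Inverts (amplify a fun x => E (F x)) G (setBlock n i x (s.take N))
      ((s.drop N).take (G.coins.eval N))) :
    (trial F E a G n (F x) s N i).isSome := by
  have hnN : n ^ (a + 1) * n ≤ N := by
    rw [← pow_succ, ← hN]; exact (root_spec (Nat.succ_ne_zero _) N).1
  have hiN : (i + 1) * n ≤ N := (Nat.mul_le_mul_right n hi).trans hnN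
  have hu : (s.take N).length = N := by rw [List.length_take, Nat.min_eq_left hs]
  have hlen : (setBlock n i x (s.take N)).length = N := by
    rw [length_setBlock hx (by rwa [hu]), hu]
  have hval : ∀ z : BitStr, z.length = N →
      amplify a (fun x => E (F x)) z = mapBlocks (fun x => E (F x)) n (n ^ (a + 1)) z := by
    intro z hz
    rw [amplify, hz, hN]
  unfold Inverts at h
  rw [hlen, hval _ hlen] at h
  have hset := mapBlocks_setBlock (fun x => E (F x)) hi hx (hu.symm ▸ hnN)
  obtain ⟨z, hz, hz'⟩ := Option.map_eq_some_iff.1 h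
  simp only [aux, Prod.mk.injEq] at hz'
  rw [hval z hz'.1] at hz'
  have hb := (hΦ.mapBlocks_eq (hz'.1.trans hlen.symm) (hnN.trans_eq hlen.symm) hz'.2).1 i hi
  have hbx : block n i (setBlock n i x (s.take N)) = x := by
    have hl : ((s.take N).take (i * n)).length = i * n := by
      rw [List.length_take, hu, Nat.min_eq_left]
      exact (Nat.mul_le_mul_right n (Nat.le_succ i)).trans hiN
    rw [block, setBlock, List.append_assoc, List.drop_left' hl, List.take_left' hx]
  rw [hbx] at hb
  have hFz : F (block n i z) = F x := hE hb
  have hlz : (block n i z).length = n := by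
    have : (i + 1) * n = i * n + n := by ring
    rw [block, List.length_take, List.length_drop, hz'.1, Nat.min_eq_left]
    lia
  have hc : candidate F E a G n (F x) s N i = block n i z := by
    rw [candidate, ← hset, hz, Option.getD_some]
  simp [trial, hc, hFz, hlz]

theorem PT.trial {F E : BitStr → BitStr} (hF : PT F) (hE : PT E) (a : ℕ) (G : PPT)
    {n N i : α → ℕ} {y s : α → BitStr} (hn : PT n) (hy : PT y) (hs : PT s) (hN : PT N)
    (hi : PT i) : PT fun w => OneWay.trial F E a G (n w) (y w) (s w) (N w) (i w) := by
  have hΦ : PT fun x => E (F x) := hE.comp hF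
  have hx := hN.take hs
  have hY := ((hΦ.mapBlocks hn hi ((hi.mul hn).take hx)).append (hE.comp hy)).append
    (hΦ.mapBlocks hn (((hn.pow (a + 1)).sub (PT.const 1)).sub hi)
      (((hi.add (PT.const 1)).mul hn).drop hx))
  have hv : PT fun w => candidate F E a G (n w) (y w) (s w) (N w) (i w) :=
    hn.block hi
      (G.pt.comp (hN.pair (hY.pair ((hN.eval G.coins).take (hN.drop hs))))).getD_nil
  exact ((hv.length.nat_eq hn).and ((hF.comp hv).eq_bits hy)).cond hv.some (PT.const none)

/-- The number of random bits of a trial: a bound, valid for all `N ≤ (n + 1) ^ (a + 2)`, for the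
`N` bits of the argument and the coins of `G`. -/
noncomputable def trialCoins (a : ℕ) (G : PPT) : ℕ[X] :=
  (X + 1) ^ (a + 2) + G.coins.comp ((X + 1) ^ (a + 2))

/-- The number of trials for each `N` and `i`. It is `n / ε` for
`ε = δ / (2 n ^ (a + 1))` and `δ = (n + 1) ^ (-(a + 2) b)`. -/
noncomputable def trialCount (a b : ℕ) : ℕ[X] := 2 * X ^ (a + 2) * (X + 1) ^ ((a + 2) * b)

/-- The reduction: the result of the first successful trial. The length `N` for which `G` does well
is unknown, so that all the possible lengths are tried. -/
noncomputable def reduction (F E : BitStr → BitStr) (a b : ℕ) (G : PPT) (w : Psi) :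
    Option BitStr :=
  (List.range ((w.1 + 1) ^ (a + 2))).findSome? fun N =>
    (List.range (w.1 ^ (a + 1))).findSome? fun i =>
      (List.range ((trialCount a b).eval w.1)).findSome? fun t =>
        trial F E a G w.1 w.2.1 (block ((trialCoins a G).eval w.1) t w.2.2) N i

theorem PT.reduction {F E : BitStr → BitStr} (hF : PT F) (hE : PT E) (a b : ℕ) (G : PPT) :
    PT (reduction F E a b G) := by
  have hn : PT fun p : ((Psi × ℕ) × ℕ) × ℕ => p.1.1.1.1 :=
    PT.fst.comp (PT.fst.comp (PT.fst.comp PT.fst))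
  have hyr : PT fun p : ((Psi × ℕ) × ℕ) × ℕ => p.1.1.1.2 :=
    PT.snd.comp (PT.fst.comp (PT.fst.comp PT.fst))
  have ht := hF.trial hE a G hn (PT.fst.comp hyr)
    ((hn.eval (trialCoins a G)).block PT.snd (PT.snd.comp hyr))
    (PT.snd.comp (PT.fst.comp PT.fst)) (PT.snd.comp PT.fst)
  have h₁ := PT.findSome (n := fun p : (Psi × ℕ) × ℕ => (trialCount a b).eval p.1.1.1)
    (g := fun p t => OneWay.trial F E a G p.1.1.1 p.1.1.2.1
      (OneWay.block ((trialCoins a G).eval p.1.1.1) t p.1.1.2.2) p.1.2 p.2) ht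
    ((PT.fst.comp (PT.fst.comp PT.fst)).eval _)
  have h₂ := PT.findSome (n := fun p : Psi × ℕ => p.1.1 ^ (a + 1))
    (g := fun p i => (List.range ((trialCount a b).eval p.1.1)).findSome? fun t =>
      OneWay.trial F E a G p.1.1 p.1.2.1
        (OneWay.block ((trialCoins a G).eval p.1.1) t p.1.2.2) p.2 i) h₁
    ((PT.fst.comp PT.fst).pow _)
  exact PT.findSome (n := fun p : Psi => (p.1 + 1) ^ (a + 2)) h₂
    ((PT.fst.add (PT.const 1)).pow _)

/-- The reduction as a probabilistic function. -/
noncomputable def reductionPPT {F E : BitStr → BitStr} (hF : PT F) (hE : PT E) (a b : ℕ)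
    (G : PPT) : PPT :=
  .ofPT (trialCount a b * trialCoins a G) (reduction F E a b G) (hF.reduction hE a b G)

/-- One successful trial suffices, since every result of a trial is correct. -/
theorem inverts_reductionPPT {F E : BitStr → BitStr} (hF : PT F) (hE : PT E) {a b : ℕ}
    {G : PPT} {n N i t : ℕ} {x r : BitStr} (hx : x.length = n) (hN : N < (n + 1) ^ (a + 2))
    (hi : i < n ^ (a + 1)) (ht : t < (trialCount a b).eval n)
    (h : (trial F E a G n (F x) (block ((trialCoins a G).eval n) t r) N i).isSome) :
    Inverts F (reductionPPT hF hE a b G) x r := by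
  subst hx
  have hsome : (reduction F E a b G (x.length, F x, r)).isSome := by
    simp only [reduction, List.findSome?_isSome_iff, List.mem_range]
    exact ⟨N, hN, i, hi, t, ht, h⟩
  obtain ⟨v, hv⟩ := Option.isSome_iff_exists.1 hsome
  have hv' := hv
  obtain ⟨N', -, hv⟩ := List.exists_of_findSome?_eq_some hv
  obtain ⟨i', -, hv⟩ := List.exists_of_findSome?_eq_some hv
  obtain ⟨t', -, hv⟩ := List.exists_of_findSome?_eq_some hv
  obtain ⟨h₁, h₂⟩ := trial_sound hv
  change (reduction F E a b G (x.length, F x, r)).map (aux F) = some (x.length, F x)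
  rw [hv', Option.map_some, aux, h₁, h₂]

end Amplification

section Analysis

/-! ### The success probability of the reduction -/

theorem root_tendsto {d : ℕ} (hd : d ≠ 0) :
    Filter.Tendsto (root d) Filter.atTop Filter.atTop := by
  refine Filter.tendsto_atTop.2 fun m => ?_
  filter_upwards [Filter.eventually_ge_atTop (m ^ d)] with N hN
  by_contra h
  exact absurd ((root_spec hd N).2.trans_le (Nat.pow_le_pow_left (not_le.1 h) d)) (not_lt.2 hN)

/-- The probability that `G` inverts `F` at `x`. -/
noncomputable def invertProbAt (F : BitStr → BitStr) (G : PPT) (N : ℕ) (x : BitStr) : ℝ :=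
  avg (G.coins.eval N) fun r => ind (Inverts F G x r)

/-- A trial for the right length `N` succeeds at least as often as `G` inverts the amplified
function at random strings whose `i`-th block is `x`. -/
theorem le_avg_trial {F E : BitStr → BitStr} (hE : Injective E)
    (hΦ : Decodable fun x => E (F x)) {a : ℕ} {G : PPT} {n N i : ℕ} (hN : root (a + 2) N = n)
    (hi : i < n ^ (a + 1)) {x : BitStr} (hx : x.length = n) :
    avg N (fun u => invertProbAt (amplify a fun x => E (F x)) G N (setBlock n i x u)) ≤
      avg ((trialCoins a G).eval n) fun s => ind (trial F E a G n (F x) s N i).isSome := by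
  set F' := amplify a fun x => E (F x)
  set q := G.coins.eval N
  have hNn : N ≤ (n + 1) ^ (a + 2) := by
    rw [← hN]; exact (root_spec (Nat.succ_ne_zero _) N).2.le
  have hB : N + q ≤ (trialCoins a G).eval n := by
    simp only [trialCoins, eval_add, eval_pow, eval_X, eval_one, eval_comp]
    exact Nat.add_le_add hNn (eval_mono G.coins hNn)
  have h₁ : avg N (fun u => invertProbAt F' G N (setBlock n i x u)) = avg (N + q) fun s =>
      ind (Inverts F' G (setBlock n i x (s.take N)) (s.drop N)) := by
    rw [avg_append]
    refine avg_congr fun u hu => avg_congr fun r _ => ?_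
    rw [List.take_left' hu, List.drop_left' hu]
  rw [h₁, ← avg_take hB]
  refine avg_mono fun s hs => ind_mono fun h => ?_
  rw [List.take_take, Nat.min_eq_left (Nat.le_add_right N q), List.drop_take,
    Nat.add_sub_cancel_left] at h
  exact trial_isSome hE hΦ hN hi hx (hs ▸ (Nat.le_add_right N q).trans hB) h

/-- The strings `x` of length `n` are divided into bad ones, which `G` rarely inverts wherever they
are planted, and good ones. Here `β` is the probability of the bad strings. -/
theorem exists_bad_prob {F E : BitStr → BitStr} (hF : PT F) (hE : PT E) (hinj : Injective E)
    (hΦ : Decodable fun x => E (F x)) (a b : ℕ) (G : PPT) {n N : ℕ} (hN : root (a + 2) N = n)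
    {ε : ℝ} (h₀ : 0 ≤ ε) (h₁ : ε ≤ 1) :
    ∃ β : ℝ, β ≤ 1 ∧
      invertProb (amplify a fun x => E (F x)) G N ≤
        (1 - β) ^ n ^ (a + 1) + (n ^ (a + 1) : ℕ) * ε ∧
      1 - β - (1 - ε) ^ (trialCount a b).eval n ≤ invertProb F (reductionPPT hF hE a b G) n := by
  obtain ⟨hn, hn'⟩ := root_spec (Nat.succ_ne_zero (a + 1)) N
  rw [show (a + 1).succ = a + 2 from rfl, hN] at hn hn'
  obtain ⟨m, hm⟩ := Nat.exists_eq_add_of_le hn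
  rw [show a + 2 = a + 1 + 1 from rfl, pow_succ] at hm
  set F' := amplify a fun x => E (F x)
  let Bad : BitStr → Prop := fun x =>
    ∀ i < n ^ (a + 1), avg N (fun u => invertProbAt F' G N (setBlock n i x u)) ≤ ε
  refine ⟨avg n fun x => ind (Bad x), avg_le_one fun _ _ => ind_le_one _, ?_, ?_⟩
  · rw [invertProb_eq_avg]
    have := avg_le_of_bad n (n ^ (a + 1)) m (invertProbAt F' G N)
      (fun x => avg_nonneg fun _ _ => ind_nonneg _) (fun x => avg_le_one fun _ _ => ind_le_one _)
      Bad ε (by rw [← hm]; exact fun x _ h => h) h₀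
    rw [← hm] at this
    exact this
  · rw [invertProb_eq_avg, sub_sub, ← avg_const n ((1 - ε) ^ _), ← avg_add, ← avg_one_sub]
    refine avg_mono fun x hx => ?_
    have hpow : 0 ≤ (1 - ε) ^ (trialCount a b).eval n := pow_nonneg (sub_nonneg.2 h₁) _
    by_cases hb : Bad x
    · rw [ind_true hb]
      exact le_trans (by linarith) (avg_nonneg fun _ _ => ind_nonneg _)
    rw [ind_false hb, zero_add]
    simp only [Bad, not_forall, not_le] at hb
    obtain ⟨i, hi, hb⟩ := hb
    have hcoins : (reductionPPT hF hE a b G).coins.eval n =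
        (trialCount a b).eval n * (trialCoins a G).eval n + 0 := eval_mul
    set T := (trialCount a b).eval n
    set B := (trialCoins a G).eval n
    -- The trials for the fixed `N` and `i` use disjoint, hence independent, blocks of the coins.
    let fail : BitStr → ℝ := fun s => 1 - ind (trial F E a G n (F x) s N i).isSome
    have hfail : avg B fail ≤ 1 - ε := by
      rw [avg_one_sub]
      linarith [le_avg_trial (G := G) hinj hΦ hN hi hx]
    have hfail₀ : 0 ≤ avg B fail := avg_nonneg fun s _ => sub_nonneg.2 (ind_le_one _)
    refine (sub_le_sub_left (pow_le_pow_left₀ hfail₀ hfail T) 1).trans ?_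
    rw [hcoins, ← avg_prod_block B T 0, ← avg_one_sub]
    refine avg_mono fun r _ => ?_
    by_cases ht : ∃ t < T, (trial F E a G n (F x) (block B t r) N i).isSome
    · obtain ⟨t, ht, hs⟩ := ht
      rw [ind_true (inverts_reductionPPT hF hE hx hn' hi ht hs)]
      exact sub_le_self _ (Finset.prod_nonneg fun _ _ => sub_nonneg.2 (ind_le_one _))
    · push Not at ht
      have : ∏ t ∈ Finset.range T, fail (block B t r) = 1 :=
        Finset.prod_eq_one fun t h => by
          simp only [fail, ind_false (ht t (Finset.mem_range.1 h)), sub_zero]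
      rw [this, sub_self]
      exact ind_nonneg _

/-! ### Asymptotics -/

/-- The choice of the parameters: if the amplified function is inverted with probability `δ ≥ 1 /
P`, where `P` is the value at `n` of a fixed polynomial, and `n` is large, then the failure
probability of the reduction is less than `1 / n ^ a`. Both terms are below `1 / (2 n ^ a)`: a
larger `β` would make `(1 - β) ^ (n ^ (a + 1))` exponentially small, and the number of trials is
chosen to be at least `n / ε`. -/
theorem bad_prob_add_lt {a b n : ℕ} (hn : 1 ≤ n) {P δ ε β : ℝ}
    (hP : P = ((n : ℝ) + 1) ^ ((a + 2) * b))
    (h₁ : 2 * P * Real.exp (-(n / 2)) < 1) (h₂ : 2 * (n : ℝ) ^ a * Real.exp (-n) < 1)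
    (hδ : 1 ≤ δ * P) (hε : ε = δ / (2 * (n : ℝ) ^ (a + 1))) (hε₁ : ε ≤ 1) (hβ₁ : β ≤ 1)
    (hβ : δ ≤ (1 - β) ^ n ^ (a + 1) + (n ^ (a + 1) : ℕ) * ε) :
    β + (1 - ε) ^ (trialCount a b).eval n < 1 / (n : ℝ) ^ a := by
  have hn₀ : (0 : ℝ) < n := by exact_mod_cast hn
  have hna : (0 : ℝ) < (n : ℝ) ^ a := pow_pos hn₀ a
  have hP₀ : 0 < P := by rw [hP]; positivity
  have pow_le : ∀ (t : ℝ) (k : ℕ), t ≤ 1 → (1 - t) ^ k ≤ Real.exp (-(t * k)) := by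
    intro t k ht
    rw [← neg_mul, mul_comm, Real.exp_nat_mul]
    exact pow_le_pow_left₀ (sub_nonneg.2 ht) (Real.one_sub_le_exp_neg t) k
  have hβ' : β < 1 / (2 * (n : ℝ) ^ a) := by
    by_contra! h
    have e₁ : ((n ^ (a + 1) : ℕ) : ℝ) * ε = δ / 2 := by
      rw [hε]; push_cast; field_simp
    have e₂ : (n : ℝ) / 2 ≤ β * (n ^ (a + 1) : ℕ) := by
      have := mul_le_mul_of_nonneg_right h (pow_pos hn₀ (a + 1)).le
      push_cast
      refine le_trans (le_of_eq ?_) this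
      rw [pow_succ]; field_simp
    have e₃ : δ / 2 ≤ Real.exp (-(n / 2)) := by
      have := (pow_le β (n ^ (a + 1)) hβ₁).trans (Real.exp_le_exp.2 (neg_le_neg e₂))
      linarith
    have e₄ := mul_le_mul_of_nonneg_right e₃ hP₀.le
    linarith
  have hfail : (1 - ε) ^ (trialCount a b).eval n < 1 / (2 * (n : ℝ) ^ a) := by
    have e₁ : (n : ℝ) ≤ ε * ((trialCount a b).eval n : ℕ) := by
      have : ε * ((trialCount a b).eval n : ℕ) = δ * P * n := by
        simp only [trialCount, eval_mul, eval_pow, eval_add, eval_X, eval_one, eval_ofNat]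
        push_cast
        rw [hε, hP, pow_succ, pow_succ, pow_succ]
        field_simp
      rw [this]
      exact le_mul_of_one_le_left hn₀.le hδ
    refine ((pow_le ε _ hε₁).trans (Real.exp_le_exp.2 (neg_le_neg e₁))).trans_lt ?_
    rw [lt_div_iff₀ (by positivity)]
    linarith
  have : 1 / (n : ℝ) ^ a = 1 / (2 * (n : ℝ) ^ a) + 1 / (2 * (n : ℝ) ^ a) := by
    field_simp; norm_num
  linarith

theorem eventually_pow_mul_exp_lt (k : ℕ) :
    ∀ᶠ n : ℕ in Filter.atTop, 2 * ((n : ℝ) + 1) ^ k * Real.exp (-(n / 2)) < 1 := by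
  have h := (Real.tendsto_pow_mul_exp_neg_atTop_nhds_zero k).comp
    ((tendsto_natCast_atTop_atTop (R := ℝ)).atTop_add (tendsto_const_nhds (x := (1 : ℝ)))
      |>.atTop_div_const (zero_lt_two))
  have hc : (0 : ℝ) < 1 / (2 * 2 ^ k * Real.exp (1 / 2)) := by positivity
  filter_upwards [h.eventually (gt_mem_nhds hc)] with n hn
  simp only [Function.comp_apply] at hn
  rw [lt_div_iff₀ (by positivity)] at hn
  refine lt_of_eq_of_lt ?_ hn
  have : -((n : ℝ) / 2) = -(((n : ℝ) + 1) / 2) + 1 / 2 := by ring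
  rw [this, Real.exp_add, div_pow]
  field_simp

/-- Hardness amplification. The exponent `a` depends only on the exponent of weak one-wayness,
whereas the number of trials of the reduction depends on the exponent `c'` of the supposed success
probability. -/
theorem IsWeaklyOneWay.exists_amplify {F E : BitStr → BitStr} (hF : IsWeaklyOneWay F) (hE : PT E)
    (hinj : Injective E) (hΦ : Decodable fun x => E (F x)) :
    ∃ a, IsStronglyOneWay (amplify a fun x => E (F x)) := by
  obtain ⟨hpoly, c, -, hweak⟩ := hF
  have hFPT := polyTime_iff_pt.1 hpoly
  refine ⟨⌈c⌉₊, polyTime_iff_pt.2 (PT.amplify _ (hE.comp hFPT)), fun c' _ G => ?_⟩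
  set a := ⌈c⌉₊
  set b := ⌈c'⌉₊
  set F' := amplify a fun x => E (F x)
  -- The four facts needed about the block length `n` hold for large `n`, hence for large `N`.
  have hev := (root_tendsto (Nat.succ_ne_zero (a + 1))).eventually
    ((hweak (reductionPPT hFPT hE a b G)).and
    ((eventually_pow_mul_exp_lt ((a + 2) * b)).and
    ((eventually_pow_mul_exp_lt a).and (Filter.eventually_ge_atTop 1))))
  filter_upwards [hev, Filter.eventually_ge_atTop 1] with N hev hN₁
  by_contra! hδ
  set n := root (a + 2) N with hn
  obtain ⟨hw, h₁, h₂, hn₁⟩ := hev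
  change invertProb F _ n ≤ 1 - (n : ℝ) ^ (-c) at hw
  change 2 * ((n : ℝ) + 1) ^ ((a + 2) * b) * Real.exp (-((n : ℝ) / 2)) < 1 at h₁
  change 2 * ((n : ℝ) + 1) ^ a * Real.exp (-((n : ℝ) / 2)) < 1 at h₂
  change 1 ≤ n at hn₁
  set δ := invertProb F' G N with hδ_def
  have hn₀ : (0 : ℝ) < n := by exact_mod_cast hn₁
  have hN₀ : (1 : ℝ) ≤ N := by exact_mod_cast hN₁
  have h₂' : 2 * (n : ℝ) ^ a * Real.exp (-n) < 1 := by
    refine lt_of_le_of_lt ?_ h₂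
    gcongr
    · linarith
    · linarith
  have hδ₁ : δ ≤ 1 := by
    rw [hδ_def, invertProb_eq_avg]
    exact avg_le_one fun _ _ => avg_le_one fun _ _ => ind_le_one _
  have hδP : 1 ≤ δ * ((n : ℝ) + 1) ^ ((a + 2) * b) := by
    have e₁ : (N : ℝ) ^ c' ≤ ((n : ℝ) + 1) ^ ((a + 2) * b) := by
      calc (N : ℝ) ^ c' ≤ (N : ℝ) ^ (b : ℝ) :=
            Real.rpow_le_rpow_of_exponent_le hN₀ (Nat.le_ceil c')
        _ = (N : ℝ) ^ b := Real.rpow_natCast _ _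
        _ ≤ (((n : ℝ) + 1) ^ (a + 2)) ^ b := by
          gcongr
          exact_mod_cast (root_spec (Nat.succ_ne_zero (a + 1)) N).2.le
        _ = _ := (pow_mul _ _ _).symm
    have e₂ : 0 < (N : ℝ) ^ c' := Real.rpow_pos_of_pos (by linarith) _
    rw [Real.rpow_neg (by linarith)] at hδ
    calc (1 : ℝ) = ((N : ℝ) ^ c')⁻¹ * (N : ℝ) ^ c' := (inv_mul_cancel₀ e₂.ne').symm
      _ ≤ δ * ((n : ℝ) + 1) ^ ((a + 2) * b) :=
        mul_le_mul hδ.le e₁ e₂.le ((inv_pos.2 e₂).trans hδ).le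
  have hδ₀ : 0 < δ := (Real.rpow_pos_of_pos (by linarith) _).trans hδ
  have hε₁ : δ / (2 * (n : ℝ) ^ (a + 1)) ≤ 1 := by
    rw [div_le_one (by positivity)]
    have : (1 : ℝ) ≤ (n : ℝ) ^ (a + 1) := one_le_pow₀ (by exact_mod_cast hn₁)
    linarith
  obtain ⟨β, hβ₁, hβ, hR⟩ := exists_bad_prob hFPT hE hinj hΦ a b G hn.symm
    (ε := δ / (2 * (n : ℝ) ^ (a + 1))) (by positivity) hε₁
  have hlt := bad_prob_add_lt hn₁ rfl h₁ h₂' hδP rfl hε₁ hβ₁ hβ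
  have hc : 1 / (n : ℝ) ^ a ≤ (n : ℝ) ^ (-c) := by
    rw [Real.rpow_neg hn₀.le, one_div, ← Real.rpow_natCast]
    exact inv_anti₀ (Real.rpow_pos_of_pos hn₀ _)
      (Real.rpow_le_rpow_of_exponent_le (by exact_mod_cast hn₁) (Nat.le_ceil c))
  linarith

/-! ### Functions and permutations -/

theorem dbl_append_inj {x y u v : BitStr} (h : dbl x ++ u = dbl y ++ v) : x = y ∧ u = v := by
  induction x generalizing y with
  | nil => cases y <;> simp_all [dbl]
  | cons a x ih =>
    rcases y with _ | ⟨b, y⟩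
    · simp [dbl] at h
    · have e : ∀ (a : Bool) (x : BitStr), dbl (a :: x) = true :: a :: dbl x := by simp [dbl]
      simp only [e, List.cons_append, List.cons.injEq, true_and] at h
      obtain ⟨rfl, rfl⟩ := ih h.2
      exact ⟨by rw [h.1], rfl⟩

theorem dbl_injective : Injective dbl := fun x y h =>
  (dbl_append_inj (u := []) (v := []) (by rw [h])).1

theorem IsLengthPreservingPerm.decodable {F : BitStr → BitStr} (h : IsLengthPreservingPerm F) :
    Decodable F := fun x x' _ _ hx he =>
  List.append_inj he (((h x.length).mapsTo rfl).trans
    (hx.trans ((h x'.length).mapsTo rfl).symm))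

theorem length_mapBlocks {F : BitStr → BitStr} (hF : ∀ x, (F x).length = x.length) (n k : ℕ)
    (x : BitStr) : (mapBlocks F n k x).length = x.length := by
  induction k generalizing x with
  | zero => rfl
  | succ k ih =>
    rw [mapBlocks, List.length_append, hF, ih, ← List.length_append, List.take_append_drop]

theorem mapBlocks_injective {F : BitStr → BitStr} (hF : IsLengthPreservingPerm F) (n k : ℕ)
    {x y : BitStr} (hlen : x.length = y.length) (h : mapBlocks F n k x = mapBlocks F n k y) :
    x = y := by
  induction k generalizing x y with
  | zero => exact h
  | succ k ih =>
    have ht : (x.take n).length = (y.take n).length := by simp only [List.length_take, hlen]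
    obtain ⟨h₁, h₂⟩ := hF.decodable _ _ _ _ ht h
    rw [← List.take_append_drop n x, ← List.take_append_drop n y,
      (hF _).injOn rfl ht.symm h₁, ih (by simp only [List.length_drop, hlen]) h₂]

theorem IsLengthPreservingPerm.amplify {F : BitStr → BitStr} (hF : IsLengthPreservingPerm F)
    (a : ℕ) : IsLengthPreservingPerm (amplify a F) := by
  intro n
  have hlen : ∀ x, (F x).length = x.length := fun x => (hF x.length).mapsTo rfl
  have hmaps : Set.MapsTo (OneWay.amplify a F) {x | x.length = n} {x | x.length = n} :=
    fun x hx => (length_mapBlocks hlen _ _ x).trans hx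
  have hinj : Set.InjOn (OneWay.amplify a F) {x | x.length = n} := by
    intro x hx y hy h
    have hxy : x.length = y.length := Eq.trans hx (Eq.symm hy)
    rw [OneWay.amplify, OneWay.amplify, hxy] at h
    exact mapBlocks_injective hF _ _ hxy h
  exact ⟨hmaps, hinj, (Set.eq_of_subset_of_ncard_le hmaps.image_subset
    hinj.ncard_image.ge (List.finite_length_eq Bool n)).ge⟩

end Analysis

end OneWay

theorem mainTheorem5 :
    ((∃ F : OneWay.BitStr → OneWay.BitStr, OneWay.IsWeaklyOneWay F) →
      ∃ F' : OneWay.BitStr → OneWay.BitStr, OneWay.IsStronglyOneWay F') ∧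
    ((∃ F : OneWay.BitStr → OneWay.BitStr, OneWay.IsWeaklyOneWayPerm F) →
      ∃ F' : OneWay.BitStr → OneWay.BitStr, OneWay.IsStronglyOneWayPerm F') := by
  constructor
  · rintro ⟨F, hF⟩
    obtain ⟨a, ha⟩ := hF.exists_amplify OneWay.PT.dbl OneWay.dbl_injective fun _ _ _ _ _ h =>
      let ⟨h₁, h₂⟩ := OneWay.dbl_append_inj h
      ⟨congrArg OneWay.dbl h₁, h₂⟩
    exact ⟨_, ha⟩
  · rintro ⟨F, hF, hperm⟩
    obtain ⟨a, ha⟩ := hF.exists_amplify OneWay.PT.id Function.injective_id hperm.decodable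
    exact ⟨_, ha, hperm.amplify a⟩
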